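/- Let $(X,\mathcal B,p)$ be a non-atomic standard (Lebesgue) probability space, and let $f=\sum_{i=1}^m a_i 1_{A_i}$ be a measurable step function with finitely many steps, where $a_i\in\mathbb R$, the sets $A_i$ are measurable and pairwise disjoint, $p(\bigcup_i A_i)=1$, and $\int_X f\,dp=0$. Then there are an ergodic invertible measure-preserving transformation $\tau$ of $(X,\mathcal B,p)$ and a function $g\in L_\infty(X,p)$ with $f=g-g\circ\tau$ almost everywhere, such that $\tau$ belongs to (at least) one of the following categories: 1. $\tau$ has discrete spectrum, i.e. its eigenfunctions span a dense subspace of $L_2(X,p;\mathbb C)$, and $\tau$ is rank-one of odometer type: there are columns with levels $B_k,\tau B_k,\dots,\tau^{h_k-1}B_k$ ($k\ge 0$), each consisting of pairwise disjoint measurable sets that fill $X$ up to a null set, with $h_k\mid h_{k+1}$ and $B_{k+1}\subseteq B_k$, such that every measurable set can be approximated in measure by unions of levels of these columns; 2. $\tau$ is isomorphic (modulo null sets) to a product of rotations, i.e. to a translation $x\mapsto x+\alpha$ of a torus $(\mathbb R/\mathbb Z)^d$, $d\ge 1$, with normalized Lebesgue measure; 3. $\tau$ is a finite extension of a product of rotations,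 in both senses of the term: (a) for some $d,k\ge1$ and some translation $R_\alpha$ of $(\mathbb R/\mathbb Z)^d$ there is a factor map from $(X,p,\tau)$ onto $R_\alpha$ that is almost everywhere $k$-to-one; and (b) for some $d\ge 1$, some translation $R=R_{\alpha'}$ of $Y=(\mathbb R/\mathbb Z)^d$ and some bounded measurable $n:Y\to\{0,1,2,\dots\}$, $\tau$ is isomorphic to the tower over $R$ on $\{(y,i)\in Y\times\mathbb Z: 0\le i\le n(y)\}$ with normalized product measure, $(y,i)\mapsto (y,i+1)$ if $i<n(y)$ and $(y,n(y))\mapsto(Ry,0)$. -/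

import Mathlib

open MeasureTheory Filter
open scoped ENNReal

/-- `f` is a measurable step function with finitely many steps: almost everywhere
`f = ∑ i, a i * 1_{A i}`, where the sets `A i` are measurable (up to null sets), pairwise disjoint
and of total measure one. -/
def IsFiniteStep {X : Type*} [MeasurableSpace X] (p : Measure X) (f : X → ℝ) : Prop :=
  ∃ (m : ℕ) (a : Fin m → ℝ) (A : Fin m → Set X),
    (∀ i, NullMeasurableSet (A i) p) ∧
    (∀ i j, i ≠ j → Disjoint (A i) (A j)) ∧
    p (⋃ i, A i) = 1 ∧
    f =ᵐ[p] fun x => ∑ i, (A i).indicator (fun _ => a i) x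

/-- `f` is a `τ`-coboundary with an essentially bounded (measurable) transfer function `g`. -/
def IsBoundedCoboundary {X : Type*} [MeasurableSpace X] (p : Measure X) (τ : X → X)
    (f : X → ℝ) : Prop :=
  ∃ g : X → ℝ, MemLp g ∞ p ∧ f =ᵐ[p] fun x => g x - g (τ x)

/-- Isomorphism modulo null sets of the measure preserving systems `(X, p, τ)` and `(Y, q, S)`. -/
def IsIsomorphicMod0 {X Y : Type*} [MeasurableSpace X] [MeasurableSpace Y]
    (p : Measure X) (τ : X → X) (q : Measure Y) (S : Y → Y) : Prop :=
  ∃ (φ : X → Y) (ψ : Y → X),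
    MeasurePreserving φ p q ∧ MeasurePreserving ψ q p ∧
    (∀ᵐ x ∂p, ψ (φ x) = x) ∧ (∀ᵐ y ∂q, φ (ψ y) = y) ∧
    ∀ᵐ x ∂p, φ (τ x) = S (φ x)

/-- Discrete spectrum: the eigenfunctions of `g ↦ g ∘ τ` span a dense subspace of `L²(X, p; ℂ)`. -/
def HasDiscreteSpectrum {X : Type*} [MeasurableSpace X] (p : Measure X) (τ : X → X) : Prop :=
  (Submodule.span ℂ
    {g : Lp ℂ 2 p | ∃ c : ℂ, ∀ᵐ x ∂p, g (τ x) = c * g x}).topologicalClosure = ⊤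

/-- Rank one of odometer type: `τ` is obtained from a single column by repeated cutting and stacking
without spacers. The `k`-th column has base `B k`, height `h k` and levels `τ^i (B k)`, `i < h k`;
the columns fill the space, have nested bases, and their levels approximate every measurable set. -/
def IsOdometerTypeRankOne {X : Type*} [MeasurableSpace X] (p : Measure X) (τ : X → X) : Prop :=
  ∃ (h : ℕ → ℕ) (B : ℕ → Set X),
    (∀ k, 0 < h k ∧ h k ∣ h (k + 1)) ∧
    (∀ k, MeasurableSet (B k) ∧ B (k + 1) ⊆ B k) ∧
    (∀ k, ∀ i < h k, ∀ j < h k, i ≠ j → Disjoint (τ^[i] '' B k) (τ^[j] '' B k)) ∧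
    (∀ k, p (⋃ i ∈ Finset.range (h k), τ^[i] '' B k)ᶜ = 0) ∧
    ∀ A : Set X, MeasurableSet A → ∀ ε : ℝ≥0∞, 0 < ε →
      ∃ (k : ℕ) (J : Finset ℕ), J ⊆ Finset.range (h k) ∧
        p (symmDiff A (⋃ i ∈ J, τ^[i] '' B k)) < ε

/-- The `d`-dimensional torus `(ℝ/ℤ)^d`; its `volume` is normalized Lebesgue (Haar) measure. -/
abbrev Torus (d : ℕ) : Type := Fin d → UnitAddCircle

/-- The product of the circle rotations by `α 0, …, α (d - 1)`. -/
def torusRotation {d : ℕ} (α : Torus d) : Torus d → Torus d := fun x i => x i + α i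

/-- `τ` is (isomorphic to) a product of rotations. -/
def IsProductOfRotations {X : Type*} [MeasurableSpace X] (p : Measure X) (τ : X → X) : Prop :=
  ∃ (d : ℕ) (α : Torus d), 0 < d ∧
    IsIsomorphicMod0 p τ (volume : Measure (Torus d)) (torusRotation α)

/-- `(X, p, τ)` is a finite (`k`-to-one) extension of `(Y, q, S)`: there is a factor map whose
fibres, after discarding a null set of `X`, almost all consist of exactly `k` points. -/
def IsFiniteToOneExtension {X Y : Type*} [MeasurableSpace X] [MeasurableSpace Y]
    (p : Measure X) (τ : X → X) (q : Measure Y) (S : Y → Y) : Prop :=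
  ∃ (π : X → Y) (k : ℕ) (X₀ : Set X),
    MeasurePreserving π p q ∧ (∀ᵐ x ∂p, π (τ x) = S (π x)) ∧
    0 < k ∧ MeasurableSet X₀ ∧ p X₀ᶜ = 0 ∧
    ∀ᵐ y ∂q, (X₀ ∩ π ⁻¹' {y}).encard = k

/-- The tower over `S` in which the column above `y` has the levels `0, …, n y`: a point climbs one
level at a time, and from the top of its column it moves to level `0` above `S y`. -/
def towerMap {Y : Type*} (S : Y → Y) (n : Y → ℕ) : Y × ℕ → Y × ℕ :=
  fun z => if z.2 < n z.1 then (z.1, z.2 + 1) else (S z.1, 0)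

/-- The normalized product measure on `{(y, i) : i ≤ n y}`. -/
noncomputable def towerMeasure {Y : Type*} [MeasurableSpace Y] (q : Measure Y) (n : Y → ℕ) :
    Measure (Y × ℕ) :=
  ProbabilityTheory.cond (q.prod Measure.count) {z : Y × ℕ | z.2 ≤ n z.1}

/-- `(X, p, τ)` is isomorphic to a tower of bounded height over `(Y, q, S)`. -/
def IsFiniteTowerExtension {X Y : Type*} [MeasurableSpace X] [MeasurableSpace Y]
    (p : Measure X) (τ : X → X) (q : Measure Y) (S : Y → Y) : Prop :=
  ∃ (n : Y → ℕ) (N : ℕ), Measurable n ∧ (∀ y, n y ≤ N) ∧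
    IsIsomorphicMod0 p τ (towerMeasure q n) (towerMap S n)

/-- `τ` is a finite extension of a product of rotations, in both senses of the term: it has a
product of rotations as a factor with finite fibres of constant cardinality, and it is a tower of
bounded height over a product of rotations. -/
def IsFiniteExtensionOfRotations {X : Type*} [MeasurableSpace X] (p : Measure X)
    (τ : X → X) : Prop :=
  (∃ (d : ℕ) (α : Torus d), 0 < d ∧
    IsFiniteToOneExtension p τ (volume : Measure (Torus d)) (torusRotation α)) ∧
  (∃ (d : ℕ) (α : Torus d), 0 < d ∧
    IsFiniteTowerExtension p τ (volume : Measure (Torus d)) (torusRotation α))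

/-!
A mean zero step function depends only on the partition into its steps, and up to isomorphism modulo
null sets a finite partition of a non-atomic standard Borel probability space is determined by the
measures `b j` of its cells (`exists_mod0Equiv_of_map_eq`: map each space to the unit interval by a
distribution function that lays out the cells consecutively). So it suffices to find one ergodic
automorphism `T` of one such space together with sets `A j` of measure `b j` for which the functions
`1_{A j} - b j` are bounded coboundaries: as `∑ a j * b j = 0`, the step function `∑ a j 1_{A j}` is
then a bounded coboundary, and `T` is carried over by `Mod0Equiv.exists_transport`.

Such sets exist as soon as every `b j` is the angle of an eigenvalue of `T`, that is, there are maps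
`θ j` to the circle with `θ j ∘ T = θ j + b j`. They are found one after the other. If
`1_E - s = h - h ∘ T` and `β = b / s`, then `φ = θ - β h` satisfies `φ ∘ T = φ + β 1_E`, so `φ`
moves by the angle `β` on `E` and rests elsewhere. The points of `E` where `φ` passes the origin form
a subset of `E` of density `b`, with transfer function `β h + φ` for the representative of `φ` in
`(0, 1]` (`exists_boundedRemainder_subset`); then `E` is replaced by the rest of `E`. The identity
holds at every point, so integrating it against the invariant measure gives the measure of the set.

It remains to find an ergodic `T` with these eigenvalues. By linear algebra over `ℚ`, each `b j` is
`n j / N + ∑ l, c j l * α l` with integers `n j` and `c j l`, where `1` and the `N * α l` are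
rationally independent (`exists_integral_coordinates`). If there are no `α l`, a tower of height `N`
over the dyadic odometer works. It is an odometer with the cyclic factors `ℤ / (N * 2 ^ k)`, which
generate the measurable sets; the characters of these factors are eigenfunctions and span
`L²`. If there are some `α l`, a tower of height `N` over the rotation of the torus by `N α` works;
this rotation is ergodic since trigonometric polynomials determine a finite measure. The map
`(i, y) ↦ y + i α` is an `N`-to-one factor map from this tower onto the rotation by `α`. The second
of the three categories is not needed, as a product of rotations is a tower of height one over
itself.
-/

/-! ### Isomorphisms modulo null sets -/

/-- An isomorphism modulo null sets between two measure spaces: measure preserving maps in both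
directions which are almost everywhere inverse to each other. -/
structure Mod0Equiv {X Y : Type*} [MeasurableSpace X] [MeasurableSpace Y]
    (p : Measure X) (q : Measure Y) where
  /-- The forward map. -/
  toFun : X → Y
  /-- The backward map. -/
  invFun : Y → X
  measurePreserving_toFun : MeasurePreserving toFun p q
  measurePreserving_invFun : MeasurePreserving invFun q p
  left_inv : ∀ᵐ x ∂p, invFun (toFun x) = x
  right_inv : ∀ᵐ y ∂q, toFun (invFun y) = y

namespace Mod0Equiv

variable {X Y Z : Type*} [MeasurableSpace X] [MeasurableSpace Y] [MeasurableSpace Z]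
  {p : Measure X} {q : Measure Y} {r : Measure Z}

/-- The inverse isomorphism. -/
def symm (e : Mod0Equiv p q) : Mod0Equiv q p where
  toFun := e.invFun
  invFun := e.toFun
  measurePreserving_toFun := e.measurePreserving_invFun
  measurePreserving_invFun := e.measurePreserving_toFun
  left_inv := e.right_inv
  right_inv := e.left_inv

/-- Composition of isomorphisms. -/
def trans (e : Mod0Equiv p q) (e' : Mod0Equiv q r) : Mod0Equiv p r where
  toFun := e'.toFun ∘ e.toFun
  invFun := e.invFun ∘ e'.invFun
  measurePreserving_toFun := e'.measurePreserving_toFun.comp e.measurePreserving_toFun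
  measurePreserving_invFun := e.measurePreserving_invFun.comp e'.measurePreserving_invFun
  left_inv := by
    filter_upwards [e.left_inv,
      e.measurePreserving_toFun.quasiMeasurePreserving.ae e'.left_inv] with x h₁ h₂
    simp [h₁, h₂]
  right_inv := by
    filter_upwards [e'.right_inv,
      e'.measurePreserving_invFun.quasiMeasurePreserving.ae e.right_inv] with x h₁ h₂
    simp [h₁, h₂]

/-- A measure preserving map with a measurable almost everywhere left inverse is an isomorphism. -/
def ofLeftInverse [StandardBorelSpace Y] {φ : X → Y} {ψ : Y → X} (hφ : MeasurePreserving φ p q)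
    (hψ : Measurable ψ) (h : ∀ᵐ x ∂p, ψ (φ x) = x) : Mod0Equiv p q where
  toFun := φ
  invFun := ψ
  measurePreserving_toFun := hφ
  measurePreserving_invFun := by
    have h' : ψ ∘ φ =ᵐ[p] id := h
    refine ⟨hψ, ?_⟩
    rw [← hφ.map_eq, Measure.map_map hψ hφ.measurable, Measure.map_congr h', Measure.map_id]
  left_inv := h
  right_inv := by
    rw [← hφ.map_eq, ae_map_iff hφ.measurable.aemeasurable
      (show MeasurableSet {y | φ (ψ y) = y} from
        measurableSet_eq_fun (hφ.measurable.comp hψ) measurable_id)]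
    exact h.mono fun x hx => by rw [hx]

/-- A measure preserving map of standard Borel spaces which is injective off a null set is an
isomorphism modulo null sets: by the Lusin–Souslin theorem its restriction to a conull set is a
measurable embedding. -/
theorem exists_of_injOn [StandardBorelSpace X] [StandardBorelSpace Y] [Nonempty X]
    {φ : X → Y} (hφ : MeasurePreserving φ p q) {s : Set X} (hs : MeasurableSet s)
    (hps : p sᶜ = 0) (hinj : Set.InjOn φ s) : ∃ e : Mod0Equiv p q, e.toFun = φ := by
  have := hs.standardBorel
  have hemb : MeasurableEmbedding (fun x : s => φ x) :=
    (hφ.measurable.comp measurable_subtype_coe).measurableEmbedding hinj.injective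
  obtain ⟨ψ, hψ, hψφ⟩ := hemb.exists_measurable_extend (g := fun x : s => (x : X))
    measurable_subtype_coe (fun _ => inferInstance)
  have hae : ∀ᵐ x ∂p, x ∈ s := hps
  exact ⟨ofLeftInverse hφ hψ (hae.mono fun x hx => congrFun hψφ ⟨x, hx⟩), rfl⟩

end Mod0Equiv

/-! ### Distribution functions of non-atomic measures -/

section Cdf

open ProbabilityTheory Set
open scoped Topology

variable (m : Measure ℝ) [IsProbabilityMeasure m] [NullSingletonClass m]

theorem continuous_cdf_of_nullSingletonClass : Continuous (cdf m) := by
  rw [continuous_iff_continuousAt]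
  intro a
  rw [(monotone_cdf m).continuousAt_iff_leftLim_eq_rightLim, (cdf m).rightLim_eq]
  have h := (cdf m).measure_singleton a
  rw [measure_cdf, measure_singleton] at h
  have h' := ENNReal.ofReal_eq_zero.1 h.symm
  exact le_antisymm ((monotone_cdf m).leftLim_le le_rfl) (by linarith)

/-- The distribution function of a non-atomic probability measure on the line pushes it forward to
Lebesgue measure on the unit interval. -/
theorem map_cdf_of_nullSingletonClass :
    m.map (cdf m) = volume.restrict (Icc (0 : ℝ) 1) := by
  have hc := continuous_cdf_of_nullSingletonClass m
  have hm := monotone_cdf m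
  have : IsProbabilityMeasure (m.map (cdf m)) :=
    Measure.isProbabilityMeasure_map hc.measurable.aemeasurable
  refine Measure.ext_of_Iic _ _ fun t => ?_
  rw [Measure.map_apply hc.measurable measurableSet_Iic,
    Measure.restrict_apply measurableSet_Iic]
  rcases lt_or_ge t 0 with ht | ht
  · have h1 : cdf m ⁻¹' Iic t = ∅ := by
      ext x; simp only [mem_preimage, mem_Iic, mem_empty_iff_false, iff_false, not_le]
      exact ht.trans_le (cdf_nonneg m x)
    have h2 : Iic t ∩ Icc (0 : ℝ) 1 = ∅ := by
      ext x; simp only [mem_inter_iff, mem_Iic, mem_Icc, mem_empty_iff_false, iff_false]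
      intro h; linarith
    simp [h1, h2]
  rcases le_or_gt 1 t with ht1 | ht1
  · have h1 : cdf m ⁻¹' Iic t = univ := by
      ext x; simpa using (cdf_le_one m x).trans ht1
    have h2 : Iic t ∩ Icc (0 : ℝ) 1 = Icc 0 1 :=
      inter_eq_right.2 fun x hx => hx.2.trans ht1
    simp [h1, h2]
  have h2 : Iic t ∩ Icc (0 : ℝ) 1 = Icc 0 t := by
    ext x; simp only [mem_inter_iff, mem_Iic, mem_Icc]
    constructor
    · intro h; exact ⟨h.2.1, h.1⟩
    · intro h; exact ⟨h.2, h.1, by linarith⟩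
  rw [h2, Real.volume_Icc, sub_zero]
  rcases (cdf m ⁻¹' Iic t).eq_empty_or_nonempty with he | hne
  · have ht0 : t ≤ 0 := by
      refine ge_of_tendsto' (tendsto_cdf_atBot m) fun x => ?_
      by_contra! hx
      have : x ∈ cdf m ⁻¹' Iic t := hx.le
      simp [he] at this
    rw [he, measure_empty, ENNReal.ofReal_of_nonpos ht0]
  · obtain ⟨b, hb⟩ := ((tendsto_cdf_atTop m).eventually (lt_mem_nhds ht1)).exists
    have hbdd : BddAbove (cdf m ⁻¹' Iic t) := by
      refine ⟨b, fun x hx => ?_⟩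
      by_contra! hbx
      have h3 := hm hbx.le
      have h4 : cdf m x ≤ t := hx
      linarith
    have hmem : sSup (cdf m ⁻¹' Iic t) ∈ cdf m ⁻¹' Iic t :=
      (isClosed_Iic.preimage hc).csSup_mem hne hbdd
    -- The sublevel set is the half-line up to its largest point `a`, where the value is `t`.
    set a := sSup (cdf m ⁻¹' Iic t) with ha
    have hset : cdf m ⁻¹' Iic t = Iic a := by
      ext x
      exact ⟨fun hx => le_csSup hbdd hx, fun hx => (hm hx).trans hmem⟩
    have hge : t ≤ cdf m a := by
      have h5 : Tendsto (cdf m) (𝓝[>] a) (𝓝 (cdf m a)) := hc.continuousAt.mono_left inf_le_left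
      refine ge_of_tendsto h5 ?_
      filter_upwards [self_mem_nhdsWithin] with x hx
      by_contra! hxt
      have : x ∈ cdf m ⁻¹' Iic t := hxt.le
      rw [hset] at this
      exact absurd (mem_Ioi.1 hx) (not_lt.2 this)
    rw [hset, ← ofReal_cdf, le_antisymm hmem hge]

end Cdf

section Matching

variable {X Y : Type*} [MeasurableSpace X] [MeasurableSpace Y] [StandardBorelSpace X]
  [StandardBorelSpace Y]

open ProbabilityTheory Set

/-- An injective measurable coordinate on a non-atomic standard Borel probability space, followed
by its distribution function, is an isomorphism with the unit interval. -/
theorem exists_mod0Equiv_unitInterval (p : Measure X) [IsProbabilityMeasure p]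
    [NullSingletonClass p] {E : X → ℝ} (hE : Measurable E) (hinj : E.Injective) :
    ∃ e : Mod0Equiv p (volume.restrict (Icc (0 : ℝ) 1)),
      e.toFun = fun x => cdf (p.map E) (E x) := by
  have : Nonempty X := p.nonempty_of_neZero
  have : IsProbabilityMeasure (p.map E) := Measure.isProbabilityMeasure_map hE.aemeasurable
  have : NullSingletonClass (p.map E) := ⟨fun t => by
    rw [Measure.map_apply hE (measurableSet_singleton t)]
    exact (subsingleton_singleton.preimage hinj).measure_zero p⟩
  have hF := (continuous_cdf_of_nullSingletonClass (p.map E)).measurable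
  have hmp : MeasurePreserving (fun x => cdf (p.map E) (E x)) p
      (volume.restrict (Icc (0 : ℝ) 1)) := by
    refine ⟨hF.comp hE, ?_⟩
    rw [← map_cdf_of_nullSingletonClass (p.map E), Measure.map_map hF hE]
    rfl
  -- Only countably many values of a monotone function are taken more than once.
  have hcount := (monotone_cdf (p.map E)).countable_setOfPred_two_preimages
  refine Mod0Equiv.exists_of_injOn hmp
    (s := (fun x => cdf (p.map E) (E x)) ⁻¹' {c | ∃ x y, x < y ∧ cdf (p.map E) x = c ∧
      cdf (p.map E) y = c}ᶜ) (hmp.measurable hcount.measurableSet.compl) ?_ ?_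
  · rw [← preimage_compl, compl_compl, hmp.measure_preimage hcount.measurableSet.nullMeasurableSet]
    exact hcount.measure_zero _
  · intro x hx y hy hxy
    simp only [mem_preimage, mem_compl_iff, mem_ofPred_eq, not_exists, not_and] at hx
    by_contra hne
    rcases lt_or_gt_of_ne (hinj.ne hne) with h | h
    · exact hx _ _ h rfl hxy.symm
    · exact hx _ _ h hxy.symm rfl

/-- The left end point of the `n`-th interval when the atoms of a law on `ℕ` are laid out
consecutively. -/
noncomputable def leftEndpoint (ν : Measure ℕ) (n : ℕ) : ℝ := ν.real (Iio n)

/-- The index of the interval between consecutive `leftEndpoint`s that contains `t`. -/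
noncomputable def intervalIndex (ν : Measure ℕ) (t : ℝ) : ℕ := sInf {n | t ≤ leftEndpoint ν (n + 1)}

/-- A non-atomic standard Borel probability space with a countable partition is isomorphic to the
unit interval in such a way that the cells become consecutive intervals. -/
theorem exists_mod0Equiv_intervalIndex (p : Measure X) [IsProbabilityMeasure p]
    [NullSingletonClass p] {u : X → ℕ} (hu : Measurable u) :
    ∃ e : Mod0Equiv p (volume.restrict (Icc (0 : ℝ) 1)),
      ∀ᵐ x ∂p, intervalIndex (p.map u) (e.toFun x) = u x := by
  have : IsProbabilityMeasure (p.map u) := Measure.isProbabilityMeasure_map hu.aemeasurable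
  -- A coordinate that lies strictly between `u x` and `u x + 1`.
  let E : X → ℝ := fun x => u x + Real.sigmoid (embeddingReal X x)
  have hlow : ∀ x, (u x : ℝ) < E x := fun x => by
    have := Real.sigmoid_pos (embeddingReal X x)
    simp only [E]; linarith
  have hup : ∀ x, E x < u x + 1 := fun x => by
    have := Real.sigmoid_lt_one (embeddingReal X x)
    simp only [E]; linarith
  have hlt : ∀ x y, u x < u y → E x < E y := fun x y h => by
    have h1 : (u x : ℝ) + 1 ≤ u y := by exact_mod_cast h
    linarith [hlow y, hup x]
  have hE : Measurable E :=
    (measurable_from_nat.comp hu).add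
      (Real.sigmoid_strictMono.monotone.measurable.comp (measurable_embeddingReal X))
  have hinj : E.Injective := by
    intro x y hxy
    have hxyu : u x = u y := by
      rcases lt_trichotomy (u x) (u y) with h | h | h
      · exact absurd hxy (hlt x y h).ne
      · exact h
      · exact absurd hxy (hlt y x h).ne'
    simp only [E, hxyu, add_right_inj] at hxy
    exact (measurableEmbedding_embeddingReal X).injective
      (Real.sigmoid_strictMono.injective hxy)
  have : IsProbabilityMeasure (p.map E) := Measure.isProbabilityMeasure_map hE.aemeasurable
  obtain ⟨e, he⟩ := exists_mod0Equiv_unitInterval p hE hinj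
  have hmono : Monotone (leftEndpoint (p.map u)) := fun a b hab =>
    measureReal_mono (Iio_subset_Iio hab)
  have hend : ∀ n, leftEndpoint (p.map u) n = p.real {x | u x < n} := fun n => by
    rw [leftEndpoint, map_measureReal_apply hu measurableSet_Iio]; rfl
  have hcdf : ∀ x, e.toFun x = p.real {y | E y ≤ E x} := fun x => by
    rw [he]
    simp only
    rw [cdf_eq_real, map_measureReal_apply hE measurableSet_Iic]; rfl
  refine ⟨e, ?_⟩
  -- Off the countable set of end points the interval is determined.
  have hne : ∀ᵐ x ∂p, e.toFun x ∉ range (leftEndpoint (p.map u)) :=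
    e.measurePreserving_toFun.quasiMeasurePreserving.ae
      ((countable_range _).ae_notMem _)
  filter_upwards [hne] with x hx
  have h1 : leftEndpoint (p.map u) (u x) ≤ e.toFun x := by
    rw [hend, hcdf]
    exact measureReal_mono fun y hy => (hlt y x hy).le
  have h2 : e.toFun x ≤ leftEndpoint (p.map u) (u x + 1) := by
    rw [hend, hcdf]
    refine measureReal_mono fun y hy => ?_
    by_contra h
    exact absurd (hlt x y (by simp at h; omega)) (not_lt.2 hy)
  have h3 : leftEndpoint (p.map u) (u x) < e.toFun x :=
    lt_of_le_of_ne h1 fun h => hx ⟨_, h⟩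
  refine le_antisymm (Nat.sInf_le h2) (le_csInf ⟨_, h2⟩ fun n hn => ?_)
  by_contra! h
  exact absurd h3 (not_lt.2 (le_trans hn (hmono h)))

/-- Two non-atomic standard Borel probability spaces with countable partitions into sets of the
same measures are isomorphic modulo null sets by a map matching the partitions. The partitions are
encoded by their index functions `u` and `v`. -/
theorem exists_mod0Equiv_of_map_eq (p : Measure X) [IsProbabilityMeasure p] [NullSingletonClass p]
    (q : Measure Y) [IsProbabilityMeasure q] [NullSingletonClass q]
    {u : X → ℕ} {v : Y → ℕ} (hu : Measurable u) (hv : Measurable v) (huv : p.map u = q.map v) :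
    ∃ e : Mod0Equiv p q, ∀ᵐ x ∂p, v (e.toFun x) = u x := by
  obtain ⟨e₁, h₁⟩ := exists_mod0Equiv_intervalIndex p hu
  obtain ⟨e₂, h₂⟩ := exists_mod0Equiv_intervalIndex q hv
  refine ⟨e₁.trans e₂.symm, ?_⟩
  filter_upwards [h₁, (e₁.trans e₂.symm).measurePreserving_toFun.quasiMeasurePreserving.ae h₂,
    e₁.measurePreserving_toFun.quasiMeasurePreserving.ae e₂.right_inv] with x hx₁ hx₂ hx₃
  rw [← hx₁, ← hx₂, huv]
  exact congrArg _ hx₃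

end Matching

/-! ### Transport of a transformation along an isomorphism modulo null sets -/

namespace Mod0Equiv

variable {X Y : Type*} [MeasurableSpace X] [MeasurableSpace Y] {p : Measure X} {q : Measure Y}

/-- An automorphism of `Y` can be carried to `X` along an isomorphism modulo null sets: on a
conull invariant set the new map `τ` is honestly conjugate to `S`, elsewhere it is the identity. -/
theorem exists_transport [StandardBorelSpace X] [StandardBorelSpace Y] (e : Mod0Equiv p q)
    (S : Y ≃ᵐ Y) (hS : MeasurePreserving S q q) :
    ∃ (τ : X ≃ᵐ X) (X₀ : Set X), MeasurePreserving τ p p ∧ MeasurableSet X₀ ∧ p X₀ᶜ = 0 ∧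
      (∀ x, τ x ∈ X₀ ↔ x ∈ X₀) ∧ (∀ x ∈ X₀, e.invFun (e.toFun x) = x) ∧
      (∀ x ∈ X₀, e.toFun (τ x) = S (e.toFun x)) ∧
      ∀ᵐ y ∂q, e.invFun y ∈ X₀ ∧ e.toFun (e.invFun y) = y := by
  classical
  obtain ⟨φ, ψ, hφ, hψ, hl, hr⟩ := e
  dsimp only
  let Y₁ : Set Y := {y | φ (ψ y) = y}
  have hY₁ : MeasurableSet Y₁ :=
    measurableSet_eq_fun (hφ.measurable.comp hψ.measurable) measurable_id
  -- The largest `S`-invariant set on which `φ ∘ ψ` is the identity.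
  let Y₂ : Set Y := {y | ∀ n : ℕ, S^[n] y ∈ Y₁ ∧ S.symm^[n] y ∈ Y₁}
  have hY₂ : MeasurableSet Y₂ := by
    have : Y₂ = ⋂ n : ℕ, (S^[n] ⁻¹' Y₁ ∩ S.symm^[n] ⁻¹' Y₁) := by
      ext y; simp [Y₂]
    rw [this]
    exact MeasurableSet.iInter fun n =>
      (S.measurable.iterate n hY₁).inter (S.symm.measurable.iterate n hY₁)
  have hY₂ae : ∀ᵐ y ∂q, y ∈ Y₂ := by
    refine ae_all_iff.2 fun n => ?_
    exact ((hS.iterate n).quasiMeasurePreserving.ae hr).and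
      (((hS.symm S).iterate n).quasiMeasurePreserving.ae hr)
  have hSY₂ : ∀ y, S y ∈ Y₂ ↔ y ∈ Y₂ := by
    intro y
    constructor
    · intro h n
      refine ⟨?_, ?_⟩
      · cases n with
        | zero => simpa using (h 1).2
        | succ n => simpa [Function.iterate_succ_apply] using (h n).1
      · simpa [Function.iterate_succ_apply] using (h (n + 1)).2
    · intro h n
      refine ⟨?_, ?_⟩
      · simpa [Function.iterate_succ_apply] using (h (n + 1)).1
      · cases n with
        | zero => simpa using (h 1).1
        | succ n => simpa [Function.iterate_succ_apply] using (h n).2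
  have hSY₂' : ∀ y, S.symm y ∈ Y₂ ↔ y ∈ Y₂ := fun y => by
    rw [← hSY₂ (S.symm y), S.apply_symm_apply]
  have hY₂₁ : ∀ y ∈ Y₂, φ (ψ y) = y := fun y hy => (hy 0).1
  let X₀ : Set X := {x | ψ (φ x) = x} ∩ φ ⁻¹' Y₂
  have hX₀ : MeasurableSet X₀ :=
    (measurableSet_eq_fun (hψ.measurable.comp hφ.measurable) measurable_id).inter
      (hφ.measurable hY₂)
  have hX₀ae : ∀ᵐ x ∂p, x ∈ X₀ := hl.and (hφ.quasiMeasurePreserving.ae hY₂ae)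
  have hψX₀ : ∀ y ∈ Y₂, ψ y ∈ X₀ := fun y hy =>
    ⟨by simp [hY₂₁ y hy], by simpa [hY₂₁ y hy] using hy⟩
  let τ : X ≃ᵐ X :=
    { toFun := fun x => if x ∈ X₀ then ψ (S (φ x)) else x
      invFun := fun x => if x ∈ X₀ then ψ (S.symm (φ x)) else x
      left_inv := by
        intro x
        by_cases hx : x ∈ X₀
        · have h := (hSY₂ (φ x)).2 hx.2
          simp only [hx, if_true, hψX₀ _ h, hY₂₁ _ h, S.symm_apply_apply]
          exact hx.1
        · simp [hx]
      right_inv := by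
        intro x
        by_cases hx : x ∈ X₀
        · have h := (hSY₂' (φ x)).2 hx.2
          simp only [hx, if_true, hψX₀ _ h, hY₂₁ _ h, S.apply_symm_apply]
          exact hx.1
        · simp [hx]
      measurable_toFun := Measurable.ite hX₀
        (hψ.measurable.comp (S.measurable.comp hφ.measurable)) measurable_id
      measurable_invFun := Measurable.ite hX₀
        (hψ.measurable.comp (S.symm.measurable.comp hφ.measurable)) measurable_id }
  have hτ : ∀ x ∈ X₀, τ x = ψ (S (φ x)) := fun x hx => if_pos hx
  have hτ' : ∀ x ∉ X₀, τ x = x := fun x hx => if_neg hx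
  refine ⟨τ, X₀, ⟨τ.measurable, ?_⟩, hX₀, hX₀ae, ?_, fun x hx => hx.1, ?_, ?_⟩
  · have : τ =ᵐ[p] ψ ∘ S ∘ φ := hX₀ae.mono hτ
    rw [Measure.map_congr this, (hψ.comp (hS.comp hφ)).map_eq]
  · intro x
    by_cases hx : x ∈ X₀
    · simp only [hx, iff_true, hτ x hx]
      exact hψX₀ _ ((hSY₂ _).2 hx.2)
    · simp [hτ' x hx]
  · intro x hx
    rw [hτ x hx, hY₂₁ _ ((hSY₂ _).2 hx.2)]
  · exact hY₂ae.mono fun y hy => ⟨hψX₀ y hy, hY₂₁ y hy⟩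

variable (e : Mod0Equiv p q) {τ : X → X} {S : Y → Y}

theorem ergodic_of_ae_conj (hτ : MeasurePreserving τ p p) (hS : Ergodic S q)
    (hconj : ∀ᵐ x ∂p, e.toFun (τ x) = S (e.toFun x)) : Ergodic τ p := by
  refine ⟨hτ, ⟨fun A hA hAτ => ?_⟩⟩
  have h1 : e.invFun ⁻¹' A =ᵐ[q] S ⁻¹' (e.invFun ⁻¹' A) := by
    filter_upwards [e.right_inv, e.measurePreserving_invFun.quasiMeasurePreserving.ae hconj,
      e.measurePreserving_invFun.quasiMeasurePreserving.ae
        (hτ.quasiMeasurePreserving.ae e.left_inv)] with y hy₁ hy₂ hy₃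
    rw [hy₁] at hy₂
    refine propext (Iff.symm ?_)
    change e.invFun (S y) ∈ A ↔ e.invFun y ∈ A
    rw [← hy₂, hy₃]
    exact Set.ext_iff.1 hAτ _
  have h2 := hS.quasiErgodic.ae_empty_or_univ₀
    (e.measurePreserving_invFun.measurable hA).nullMeasurableSet h1.symm
  have h3 : e.toFun ⁻¹' (e.invFun ⁻¹' A) =ᵐ[p] A := by
    filter_upwards [e.left_inv] with x hx
    refine propext ?_
    change e.invFun (e.toFun x) ∈ A ↔ x ∈ A
    rw [hx]
  have h4 := e.measurePreserving_toFun.quasiMeasurePreserving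
  rw [eventuallyConst_set']
  rcases h2 with h | h
  · exact Or.inl (h3.symm.trans (h4.preimage_ae_eq h))
  · exact Or.inr (h3.symm.trans (h4.preimage_ae_eq h))

theorem isIsomorphicMod0 (hconj : ∀ᵐ x ∂p, e.toFun (τ x) = S (e.toFun x)) :
    IsIsomorphicMod0 p τ q S :=
  ⟨e.toFun, e.invFun, e.measurePreserving_toFun, e.measurePreserving_invFun, e.left_inv,
    e.right_inv, hconj⟩

theorem isBoundedCoboundary (hconj : ∀ᵐ x ∂p, e.toFun (τ x) = S (e.toFun x)) {f : X → ℝ}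
    {f' : Y → ℝ} (hf : ∀ᵐ x ∂p, f x = f' (e.toFun x)) (h : IsBoundedCoboundary q S f') :
    IsBoundedCoboundary p τ f := by
  obtain ⟨g, hg, hfg⟩ := h
  refine ⟨g ∘ e.toFun, hg.comp_measurePreserving e.measurePreserving_toFun, ?_⟩
  filter_upwards [hf, hconj, e.measurePreserving_toFun.quasiMeasurePreserving.ae hfg]
    with x h1 h2 h3
  simp [h1, h2, h3]

end Mod0Equiv

/-! ### Towers of constant height -/

/-- The uniform probability measure on `Fin N`. -/
noncomputable def finUniform (N : ℕ) : Measure (Fin N) := (N : ℝ≥0∞)⁻¹ • Measure.count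

section Tower

theorem finUniform_singleton {N : ℕ} (i : Fin N) : finUniform N {i} = (N : ℝ≥0∞)⁻¹ := by
  simp [finUniform]

variable {N : ℕ} [NeZero N]

instance : IsProbabilityMeasure (finUniform N) := ⟨by
  rw [finUniform, Measure.smul_apply, Measure.count_univ]
  simp [ENNReal.inv_mul_cancel (NeZero.ne (N : ℝ≥0∞)) (ENNReal.natCast_ne_top N)]⟩

theorem forall_of_ae_finUniform {N : ℕ} {P : Fin N → Prop} (h : ∀ᵐ i ∂finUniform N, P i)
    (i : Fin N) : P i := by
  by_contra hi
  have h1 : finUniform N {i} ≤ 0 := by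
    rw [← show finUniform N {i | ¬ P i} = 0 from h]
    exact measure_mono (by simpa using hi)
  simp [finUniform_singleton] at h1

theorem measurePreserving_finUniform_add_one :
    MeasurePreserving (fun i : Fin N => i + 1) (finUniform N) (finUniform N) := by
  refine ⟨measurable_of_countable _, Measure.ext_of_singleton fun i => ?_⟩
  rw [Measure.map_apply (measurable_of_countable _) (measurableSet_singleton i)]
  have : (fun i : Fin N => i + 1) ⁻¹' {i} = {i - 1} := by
    ext j; exact (eq_sub_iff_add_eq (a := j) (b := i) (c := 1)).symm
  rw [this, finUniform_singleton, finUniform_singleton]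

variable {Ω : Type*} [MeasurableSpace Ω]

/-- The tower of constant height `N` over an automorphism `S`: a point climbs one level at a time,
and `S` acts when it passes from the top to the bottom. -/
def constTower (N : ℕ) [NeZero N] (S : Ω ≃ᵐ Ω) : Fin N × Ω ≃ᵐ Fin N × Ω where
  toFun z := (z.1 + 1, if z.1 + 1 = 0 then S z.2 else z.2)
  invFun z := (z.1 - 1, if z.1 = 0 then S.symm z.2 else z.2)
  left_inv z := by
    by_cases h : z.1 + 1 = 0
    · simp [Prod.ext_iff, eq_neg_of_add_eq_zero_left h]
    · simp [h]
  right_inv z := by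
    by_cases h : z.1 = 0
    · simp [h, Prod.ext_iff]
    · simp [h]
  measurable_toFun := by
    refine (measurable_of_countable (fun i : Fin N => i + 1)).comp measurable_fst |>.prodMk ?_
    refine Measurable.ite ?_ (S.measurable.comp measurable_snd) measurable_snd
    exact measurable_fst (Set.toFinite {i : Fin N | i + 1 = 0}).measurableSet
  measurable_invFun := by
    refine (measurable_of_countable (fun i : Fin N => i - 1)).comp measurable_fst |>.prodMk ?_
    refine Measurable.ite ?_ (S.symm.measurable.comp measurable_snd) measurable_snd
    exact measurable_fst (Set.toFinite {i : Fin N | i = 0}).measurableSet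

theorem constTower_apply (S : Ω ≃ᵐ Ω) (z : Fin N × Ω) :
    constTower N S z = (z.1 + 1, if z.1 + 1 = 0 then S z.2 else z.2) := rfl

/-- Below the top level the tower map climbs. -/
theorem constTower_of_lt (S : Ω ≃ᵐ Ω) (z : Fin N × Ω) (h : z.1.val + 1 < N) :
    constTower N S z = (⟨z.1.val + 1, h⟩, z.2) := by
  have h1 : z.1 + 1 = ⟨z.1.val + 1, h⟩ := by
    ext
    rw [Fin.val_add_one_of_lt' h]
  rw [constTower_apply, h1, if_neg]
  intro h0
  have := congrArg Fin.val h0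
  rw [Fin.val_zero] at this
  exact Nat.succ_ne_zero _ this

/-- From the top level the tower map returns to the bottom. -/
theorem constTower_of_not_lt (S : Ω ≃ᵐ Ω) (z : Fin N × Ω) (h : ¬ z.1.val + 1 < N) :
    constTower N S z = (0, S z.2) := by
  have h2 : z.1.val + 1 = N := by have := z.1.isLt; omega
  have h1 : z.1 + 1 = 0 := by
    ext
    rw [Fin.val_add, Fin.val_one', Nat.add_mod_mod, h2, Nat.mod_self, Fin.val_zero]
  rw [constTower_apply, h1, if_pos rfl]

variable {μ : Measure Ω} [IsProbabilityMeasure μ]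

theorem measurePreserving_constTower {S : Ω ≃ᵐ Ω} (hS : MeasurePreserving S μ μ) :
    MeasurePreserving (constTower N S) ((finUniform N).prod μ) ((finUniform N).prod μ) := by
  refine measurePreserving_finUniform_add_one.skew_product
    (g := fun i y => if i + 1 = 0 then S y else y) ?_ (ae_of_all _ fun i => ?_)
  · exact measurable_snd.comp (constTower N S).measurable
  · by_cases h : i + 1 = 0
    · simp [h, hS.map_eq]
    · simp [h]

/-- An invariant set of the tower has the same trace on all levels, and this trace is invariant
under `S`, as one passage through the tower acts by `S` on the bottom level. -/
theorem ergodic_constTower {S : Ω ≃ᵐ Ω} (hS : Ergodic S μ) :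
    Ergodic (constTower N S) ((finUniform N).prod μ) := by
  refine ⟨measurePreserving_constTower hS.toMeasurePreserving, ⟨fun A hA hAT => ?_⟩⟩
  have hinv : ∀ z, constTower N S z ∈ A ↔ z ∈ A := fun z => Set.ext_iff.1 hAT z
  let A₀ : Set Ω := {y | ((0 : Fin N), y) ∈ A}
  have hlev : ∀ (k : ℕ) (hk : k < N) (y : Ω), ((⟨k, hk⟩ : Fin N), y) ∈ A ↔ y ∈ A₀ := by
    intro k
    induction k with
    | zero => intro hk y; rfl
    | succ k ih =>
      intro hk y
      rw [← ih (by omega) y, ← hinv (⟨k, _⟩, y), constTower_of_lt S (⟨k, _⟩, y) hk]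
  have hA₀ : MeasurableSet A₀ := measurable_prodMk_left hA
  have hSA₀ : S ⁻¹' A₀ = A₀ := by
    ext y
    have hN := Nat.pos_of_neZero N
    rw [← hlev (N - 1) (by omega) y, ← hinv, constTower_of_not_lt S _ (by simp; omega)]
    rfl
  have hprod : A = Prod.snd ⁻¹' A₀ := by
    ext ⟨i, y⟩; exact hlev i i.2 y
  have hq := measurePreserving_snd (μ := finUniform N) (ν := μ) |>.quasiMeasurePreserving
  rw [eventuallyConst_set', hprod]
  rcases hS.toPreErgodic.ae_empty_or_univ hA₀ hSA₀ with h | h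
  · exact Or.inl (hq.preimage_ae_eq h)
  · exact Or.inr (hq.preimage_ae_eq h)

instance nullSingletonClass_finUniform_prod [NullSingletonClass μ] :
    NullSingletonClass ((finUniform N).prod μ) := ⟨fun z => by
  rw [← Prod.mk.eta (p := z), ← Set.singleton_prod_singleton, Measure.prod_prod]
  simp⟩

theorem measurePreserving_finUniform_val :
    MeasurePreserving (fun i : Fin N => (i : ℕ)) (finUniform N)
      ((N : ℝ≥0∞)⁻¹ • Measure.count.restrict (Set.Iic (N - 1))) := by
  refine ⟨measurable_of_countable _, Measure.ext_of_singleton fun n => ?_⟩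
  rw [Measure.map_apply (measurable_of_countable _) (measurableSet_singleton n)]
  have hN := Nat.pos_of_neZero N
  by_cases h : n < N
  · have h1 : (fun i : Fin N => (i : ℕ)) ⁻¹' {n} = {⟨n, h⟩} := by ext; simp [Fin.ext_iff]
    have h2 : ({n} : Set ℕ) ∩ Set.Iic (N - 1) = {n} := by
      simp; omega
    rw [h1, finUniform_singleton, Measure.smul_apply,
      Measure.restrict_apply (measurableSet_singleton n), h2]
    simp
  · have h1 : (fun i : Fin N => (i : ℕ)) ⁻¹' {n} = ∅ := by ext i; simp; omega
    have h2 : ({n} : Set ℕ) ∩ Set.Iic (N - 1) = ∅ := by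
      simp; omega
    rw [h1, Measure.smul_apply, Measure.restrict_apply (measurableSet_singleton n), h2]
    simp

theorem towerMeasure_const :
    towerMeasure μ (fun _ => N - 1) =
      μ.prod ((N : ℝ≥0∞)⁻¹ • Measure.count.restrict (Set.Iic (N - 1))) := by
  have hN := Nat.pos_of_neZero N
  have h1 : {z : Ω × ℕ | z.2 ≤ N - 1} = Set.univ ×ˢ Set.Iic (N - 1) := by ext; simp
  have h2 : (Measure.count (Set.Iic (N - 1)) : ℝ≥0∞) = N := by
    rw [← Finset.coe_Iic, Measure.count_apply_finset]
    simp
    norm_cast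
    omega
  rw [towerMeasure, h1, ProbabilityTheory.cond, Measure.prod_prod, h2, ← Measure.prod_restrict,
    Measure.restrict_univ, measure_univ, one_mul, Measure.prod_smul_right]

/-- The tower of constant height `N` is, up to the order of the coordinates, the tower with the
levels `0, …, N - 1`. -/
theorem exists_mod0Equiv_towerMeasure [StandardBorelSpace Ω] (S : Ω ≃ᵐ Ω) :
    ∃ e : Mod0Equiv ((finUniform N).prod μ) (towerMeasure μ (fun _ => N - 1)),
      ∀ z, e.toFun (constTower N S z) = towerMap S (fun _ => N - 1) (e.toFun z) := by
  have hmp : MeasurePreserving (fun z : Fin N × Ω => (z.2, (z.1 : ℕ)))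
      ((finUniform N).prod μ) (towerMeasure μ (fun _ => N - 1)) := by
    rw [towerMeasure_const]
    exact Measure.measurePreserving_swap.comp
      (measurePreserving_finUniform_val.prod (MeasurePreserving.id μ))
  refine ⟨Mod0Equiv.ofLeftInverse hmp (ψ := fun w => (Fin.ofNat N w.2, w.1)) ?_ ?_, ?_⟩
  · exact ((measurable_of_countable (fun n => Fin.ofNat N n)).comp measurable_snd).prodMk
      measurable_fst
  · exact ae_of_all _ fun z => by simp
  · intro z
    change ((constTower N S z).2, ((constTower N S z).1 : ℕ)) =
      towerMap S (fun _ => N - 1) (z.2, (z.1 : ℕ))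
    unfold towerMap
    dsimp only
    by_cases h : z.1.val + 1 < N
    · rw [constTower_of_lt S z h, if_pos (by omega)]
    · rw [constTower_of_not_lt S z h, if_neg (by omega)]
      simp

end Tower

namespace Mod0Equiv

variable {X Y Z : Type*} [MeasurableSpace X] [MeasurableSpace Y] [MeasurableSpace Z]
  {p : Measure X} {q : Measure Y} {r : Measure Z}

/-- Factor maps with finite fibres can be pulled back along an isomorphism modulo null sets. -/
theorem isFiniteToOneExtension (e : Mod0Equiv p q) {τ : X → X} {T : Y → Y} {R : Z → Z} {π : Y → Z}
    (hconj : ∀ᵐ x ∂p, e.toFun (τ x) = T (e.toFun x)) (hπ : MeasurePreserving π q r)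
    (hπT : ∀ᵐ y ∂q, π (T y) = R (π y)) {X₀ : Set X} (hX₀ : MeasurableSet X₀) (hpX₀ : p X₀ᶜ = 0)
    (hleft : ∀ x ∈ X₀, e.invFun (e.toFun x) = x)
    (hright : ∀ᵐ y ∂q, e.invFun y ∈ X₀ ∧ e.toFun (e.invFun y) = y) {k : ℕ} (hk : 0 < k)
    (hfib : ∀ Y' : Set Y, (∀ᵐ y ∂q, y ∈ Y') → ∀ᵐ z ∂r, (Y' ∩ π ⁻¹' {z}).encard = k) :
    IsFiniteToOneExtension p τ r R := by
  refine ⟨π ∘ e.toFun, k, X₀, hπ.comp e.measurePreserving_toFun, ?_, hk, hX₀, hpX₀, ?_⟩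
  · filter_upwards [hconj, e.measurePreserving_toFun.quasiMeasurePreserving.ae hπT] with x h1 h2
    simp [h1, h2]
  · filter_upwards [hfib _ hright] with z hz
    have hinj : Set.InjOn e.toFun (X₀ ∩ π ∘ e.toFun ⁻¹' {z}) := fun x hx y hy hxy => by
      rw [← hleft x hx.1, ← hleft y hy.1, hxy]
    rw [← hz, ← hinj.encard_image]
    congr 1
    ext y
    constructor
    · rintro ⟨x, ⟨hx, hxz⟩, rfl⟩
      have h := hleft x hx
      exact ⟨⟨by rwa [h], by rw [h]⟩, hxz⟩
    · rintro ⟨⟨h1, h2⟩, h3⟩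
      refine ⟨e.invFun y, ⟨h1, ?_⟩, h2⟩
      change π (e.toFun (e.invFun y)) = z
      rw [h2]; exact h3

end Mod0Equiv

/-! ### Ergodic rotations of the torus -/

section Torus

open UnitAddTorus

variable {d : ℕ}

instance isProbabilityMeasure_volume_unitAddCircle :
    IsProbabilityMeasure (volume : Measure UnitAddCircle) := ⟨UnitAddCircle.measure_univ⟩

instance nullSingletonClass_volume_unitAddCircle :
    NullSingletonClass (volume : Measure UnitAddCircle) := ⟨fun x => by
  rw [← Metric.closedBall_zero, AddCircle.volume_closedBall]
  simp⟩

theorem mFourier_apply_add (n : Fin d → ℤ) (x y : Torus d) :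
    mFourier n (x + y) = mFourier n x * mFourier n y := by
  simp only [mFourier, ContinuousMap.coe_mk, Pi.add_apply, ← Finset.prod_mul_distrib]
  refine Finset.prod_congr rfl fun i _ => ?_
  simp [fourier_apply, smul_add, AddCircle.toCircle_add]

/-- A finite measure invariant under a rotation has no Fourier coefficient at a frequency which is
non-trivial on the rotation vector. -/
theorem integral_mFourier_eq_zero_of_invariant {α : Torus d} {n : Fin d → ℤ}
    (hn : mFourier n α ≠ 1) {ρ : Measure (Torus d)}
    (hρ : MeasurePreserving (fun x => x + α) ρ ρ) : ∫ x, mFourier n x ∂ρ = 0 := by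
  have h1 : ∫ x, mFourier n (x + α) ∂ρ = ∫ x, mFourier n x ∂ρ :=
    hρ.integral_comp (MeasurableEquiv.addRight α).measurableEmbedding _
  simp only [mFourier_apply_add, integral_mul_const] at h1
  by_contra h
  exact hn (mul_left_cancel₀ h (by rw [h1, mul_one]))

/-- Unique ergodicity of irrational rotations: finite invariant measures are determined by their
total mass, as trigonometric polynomials separate finite measures. -/
theorem measure_eq_of_torusRotation_invariant {α : Torus d}
    (hα : ∀ n : Fin d → ℤ, n ≠ 0 → mFourier n α ≠ 1) {ρ ρ' : Measure (Torus d)}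
    [IsFiniteMeasure ρ] [IsFiniteMeasure ρ'] (hρ : MeasurePreserving (fun x => x + α) ρ ρ)
    (hρ' : MeasurePreserving (fun x => x + α) ρ' ρ') (h : ρ Set.univ = ρ' Set.univ) : ρ = ρ' := by
  refine ext_of_forall_mem_subalgebra_integral_eq_of_polish (𝕜 := ℂ)
    (A := (mFourierSubalgebra (Fin d)).comap (BoundedContinuousFunction.toContinuousMapStarₐ ℂ))
    ?_ ?_
  · intro x y hxy
    obtain ⟨_, ⟨f, hf, rfl⟩, hfxy⟩ := mFourierSubalgebra_separatesPoints hxy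
    exact ⟨f, ⟨f, ⟨BoundedContinuousFunction.mkOfCompact f, hf, rfl⟩, rfl⟩, hfxy⟩
  · intro g hg
    have hg' : g.toContinuousMap ∈ Submodule.span ℂ (Set.range (mFourier (d := Fin d))) := by
      rw [← mFourierSubalgebra_coe]; exact hg
    change ∫ x, g.toContinuousMap x ∂ρ = ∫ x, g.toContinuousMap x ∂ρ'
    generalize g.toContinuousMap = f at hg'
    have hint : ∀ (f : C(Torus d, ℂ)) (κ : Measure (Torus d)) [IsFiniteMeasure κ],
        Integrable f κ := fun f κ _ =>
      (BoundedContinuousFunction.mkOfCompact f).integrable κ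
    induction hg' using Submodule.span_induction with
    | mem f hf =>
      obtain ⟨n, rfl⟩ := hf
      by_cases hn : n = 0
      · subst hn
        simp [mFourier_zero, Measure.real, h]
      · rw [integral_mFourier_eq_zero_of_invariant (hα n hn) hρ,
          integral_mFourier_eq_zero_of_invariant (hα n hn) hρ']
    | zero => simp
    | add f f' _ _ hf hf' =>
      simp only [ContinuousMap.add_apply]
      rw [integral_add (hint f ρ) (hint f' ρ), integral_add (hint f ρ') (hint f' ρ'), hf, hf']
    | smul c f _ hf =>
      simp only [ContinuousMap.smul_apply]
      rw [integral_smul, integral_smul, hf]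

theorem measurePreserving_torus_add_right (α : Torus d) :
    MeasurePreserving (MeasurableEquiv.addRight α) (volume : Measure (Torus d)) volume :=
  measurePreserving_add_right volume α

theorem ergodic_torus_add_right {α : Torus d}
    (hα : ∀ n : Fin d → ℤ, n ≠ 0 → mFourier n α ≠ 1) :
    Ergodic (MeasurableEquiv.addRight α) (volume : Measure (Torus d)) := by
  have hmp := measurePreserving_torus_add_right α
  refine ⟨hmp, ⟨fun A hA hAT => ?_⟩⟩
  have h1 : MeasurePreserving (fun x => x + α) (volume.restrict A) (volume.restrict A) := by
    have := hmp.restrict_preimage hA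
    rwa [hAT] at this
  have h2 : MeasurePreserving (fun x => x + α) (volume A • (volume : Measure (Torus d)))
      (volume A • volume) := hmp.smul_measure _
  have : IsFiniteMeasure (volume A • (volume : Measure (Torus d))) :=
    Measure.smul_finite _ (measure_ne_top _ _)
  have h3 := measure_eq_of_torusRotation_invariant hα h1 h2 (by simp)
  -- Evaluate both invariant measures on the complement of `A`.
  have h4 := congrArg (fun ρ : Measure (Torus d) => ρ Aᶜ) h3
  simp only [Measure.restrict_apply hA.compl, Set.compl_inter_self, measure_empty,
    Measure.smul_apply, smul_eq_mul] at h4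
  rw [eventuallyConst_set']
  rcases mul_eq_zero.1 h4.symm with h | h
  · exact Or.inl (ae_eq_empty.2 h)
  · exact Or.inr (ae_eq_univ.2 h)

theorem mFourier_coe_eq_one_iff (n : Fin d → ℤ) (a : Fin d → ℝ) :
    mFourier n (fun i => (a i : UnitAddCircle)) = 1 ↔ ∃ k : ℤ, ∑ i, n i * a i = k := by
  have h1 : mFourier n (fun i => (a i : UnitAddCircle)) =
      Complex.exp ((∑ i, n i * a i : ℝ) * (2 * Real.pi * Complex.I)) := by
    simp only [mFourier, ContinuousMap.coe_mk, fourier_coe_apply, ← Complex.exp_sum]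
    congr 1
    push_cast
    rw [Finset.sum_mul]
    exact Finset.sum_congr rfl fun i _ => by ring
  have h2 : (2 * Real.pi * Complex.I : ℂ) ≠ 0 := Complex.two_pi_I_ne_zero
  rw [h1, Complex.exp_eq_one_iff]
  refine exists_congr fun k => ?_
  rw [mul_left_inj' h2]
  norm_cast

end Torus

/-! ### The dyadic odometer -/

section Padic

variable {p : ℕ} [Fact p.Prime]

noncomputable instance PadicInt.instMeasurableSpaceBorel : MeasurableSpace ℤ_[p] := borel _

instance PadicInt.instBorelSpace : BorelSpace ℤ_[p] := ⟨rfl⟩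

theorem PadicInt.continuous_toZModPow (n : ℕ) :
    Continuous (PadicInt.toZModPow n : ℤ_[p] →+* ZMod (p ^ n)) := by
  refine continuous_of_continuousAt_zero (PadicInt.toZModPow n : ℤ_[p] →+* ZMod (p ^ n)) ?_
  rw [ContinuousAt, map_zero, nhds_discrete (ZMod (p ^ n)), tendsto_pure]
  have hp : (0 : ℝ) < (p : ℝ) ^ (-n : ℤ) := by
    have : 0 < p := (Fact.out : p.Prime).pos
    positivity
  filter_upwards [Metric.ball_mem_nhds (0 : ℤ_[p]) hp] with x hx
  rw [← RingHom.mem_ker, PadicInt.ker_toZModPow, ← PadicInt.norm_le_pow_iff_mem_span_pow]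
  simpa using (mem_ball_zero_iff.1 hx).le

instance PadicInt.neBot_nhdsNE_zero : (nhdsWithin (0 : ℤ_[p]) {0}ᶜ).NeBot := by
  have hp : p.Prime := Fact.out
  have h1 : Tendsto (fun n : ℕ => (p : ℤ_[p]) ^ n) atTop (nhds 0) := by
    apply tendsto_pow_atTop_nhds_zero_of_norm_lt_one
    rw [PadicInt.norm_p]
    exact inv_lt_one_of_one_lt₀ (by exact_mod_cast hp.one_lt)
  refine (tendsto_nhdsWithin_iff.2 ⟨h1, Eventually.of_forall fun n => ?_⟩).neBot
  exact pow_ne_zero n (by exact_mod_cast hp.ne_zero)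

/-- Normalized Haar measure on the `p`-adic integers. -/
noncomputable def padicHaar (p : ℕ) [Fact p.Prime] : Measure ℤ_[p] := Measure.addHaarMeasure ⊤

noncomputable instance : (padicHaar p).IsAddHaarMeasure := by
  unfold padicHaar; infer_instance

instance : IsProbabilityMeasure (padicHaar p) := ⟨by
  rw [padicHaar, ← TopologicalSpace.PositiveCompacts.coe_top]
  exact Measure.addHaarMeasure_self⟩

theorem ergodic_padic_add_one :
    Ergodic (MeasurableEquiv.addLeft (1 : ℤ_[p])) (padicHaar p) := by
  refine ergodic_add_left_of_denseRange_nsmul ?_ (padicHaar p)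
  simpa using PadicInt.denseRange_natCast

end Padic

/-! ### Odometers -/

section OdometerCoordinates

variable {h : ℕ → ℕ}

/-- The sets determined by one of the coordinates `c k`. -/
def levelSets {Y : Type*} (c : ∀ k, Y → ZMod (h k)) : Set (Set Y) := {s | ∃ k J, c k ⁻¹' J = s}

theorem isSetAlgebra_levelSets {Y : Type*} {c : ∀ k, Y → ZMod (h k)} (hdvd : ∀ k, h k ∣ h (k + 1))
    (hnest : ∀ k y, ZMod.castHom (hdvd k) (ZMod (h k)) (c (k + 1) y) = c k y) :
    IsSetAlgebra (levelSets c) := by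
  have hmono : ∀ (k n : ℕ), k ≤ n → ∀ J : Set (ZMod (h k)), ∃ J', c n ⁻¹' J' = c k ⁻¹' J := by
    intro k n hkn J
    induction n, hkn using Nat.le_induction with
    | base => exact ⟨J, rfl⟩
    | succ n _ ih =>
      obtain ⟨J', hJ'⟩ := ih
      refine ⟨ZMod.castHom (hdvd n) (ZMod (h n)) ⁻¹' J', ?_⟩
      rw [← hJ']
      ext y
      exact iff_of_eq (congrArg (· ∈ J') (hnest n y))
  refine ⟨⟨0, ∅, rfl⟩, ?_, ?_⟩
  · rintro _ ⟨k, J, rfl⟩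
    exact ⟨k, Jᶜ, rfl⟩
  · rintro _ _ ⟨k, J, rfl⟩ ⟨l, J', rfl⟩
    obtain ⟨K, hK⟩ := hmono k (max k l) (le_max_left _ _) J
    obtain ⟨K', hK'⟩ := hmono l (max k l) (le_max_right _ _) J'
    exact ⟨max k l, K ∪ K', by rw [Set.preimage_union, hK, hK']⟩

variable {X Y : Type*} [MeasurableSpace X] [MeasurableSpace Y]

/-- If the nested coordinates `c k` separate the points of a standard Borel space, then their level
sets approximate every measurable set, because they generate the `σ`-algebra by the Lusin–Souslin
theorem. -/
theorem measureDense_levelSets [StandardBorelSpace Y] (q : Measure Y) [IsFiniteMeasure q]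
    {c : ∀ k, Y → ZMod (h k)} (hc : ∀ k, Measurable (c k)) (hdvd : ∀ k, h k ∣ h (k + 1))
    (hnest : ∀ k y, ZMod.castHom (hdvd k) (ZMod (h k)) (c (k + 1) y) = c k y)
    (hinj : ∀ y y', (∀ k, c k y = c k y') → y = y') : q.MeasureDense (levelSets c) := by
  refine Measure.MeasureDense.of_generateFrom_isSetAlgebra_finite q
    (isSetAlgebra_levelSets hdvd hnest) (le_antisymm ?_ ?_)
  · have (k : ℕ) : Countable (ZMod (h k)) := ZMod.intCast_surjective.countable
    have (k : ℕ) : StandardBorelSpace (ZMod (h k)) := inferInstance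
    have : StandardBorelSpace (∀ k, ZMod (h k)) := inferInstance
    have hemb : MeasurableEmbedding (fun y k => c k y) :=
      (measurable_pi_lambda _ hc).measurableEmbedding fun y y' hy => hinj y y' (congrFun hy)
    rw [← hemb.comap_eq]
    refine Measurable.comap_le ?_
    refine @measurable_pi_lambda _ _ _ (_) _ _ fun k J _ => ?_
    exact MeasurableSpace.measurableSet_generateFrom ⟨k, J, rfl⟩
  · refine MeasurableSpace.generateFrom_le ?_
    rintro _ ⟨k, J, rfl⟩
    exact hc k (by trivial)

theorem Mod0Equiv.measureDense_levelSets {p : Measure X} {q : Measure Y} (e : Mod0Equiv p q)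
    {c : ∀ k, Y → ZMod (h k)} (hd : q.MeasureDense (levelSets c)) :
    p.MeasureDense (levelSets fun k x => c k (e.toFun x)) := by
  refine ⟨?_, fun A hA hpA ε hε => ?_⟩
  · rintro _ ⟨k, J, rfl⟩
    exact e.measurePreserving_toFun.measurable (hd.measurable _ ⟨k, J, rfl⟩)
  · have hmA := e.measurePreserving_invFun.measurable hA
    obtain ⟨_, ⟨k, J, rfl⟩, ht⟩ := hd.approx (e.invFun ⁻¹' A) hmA
      (by rwa [e.measurePreserving_invFun.measure_preimage hA.nullMeasurableSet]) ε hε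
    refine ⟨_, ⟨k, J, rfl⟩, ?_⟩
    have h1 : e.toFun ⁻¹' (e.invFun ⁻¹' A) =ᵐ[p] A := by
      filter_upwards [e.left_inv] with x hx
      refine propext ?_
      change e.invFun (e.toFun x) ∈ A ↔ x ∈ A
      rw [hx]
    have h2 := e.measurePreserving_toFun.measure_preimage
      (hmA.symmDiff (hd.measurable _ ⟨k, J, rfl⟩)).nullMeasurableSet
    refine (measure_congr (ae_eq_set_symmDiff h1.symm (EventuallyEq.refl _ _))).trans_lt ?_
    exact h2.trans_lt ht

/-- Coordinates in nested cyclic groups which are advanced by one on a conull invariant set and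
whose level sets approximate all measurable sets present `τ` as an odometer. -/
theorem isOdometerTypeRankOne_of_coordinates {p : Measure X} (τ : X ≃ᵐ X) {X₀ : Set X}
    (hX₀ : MeasurableSet X₀) (hpX₀ : p X₀ᶜ = 0) (hτX₀ : ∀ x, τ x ∈ X₀ ↔ x ∈ X₀)
    (hpos : ∀ k, 0 < h k) (hdvd : ∀ k, h k ∣ h (k + 1)) {c : ∀ k, X → ZMod (h k)}
    (hc : ∀ k, Measurable (c k)) (hcτ : ∀ k, ∀ x ∈ X₀, c k (τ x) = c k x + 1)
    (hnest : ∀ k x, ZMod.castHom (hdvd k) (ZMod (h k)) (c (k + 1) x) = c k x)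
    (hdense : p.MeasureDense (levelSets c)) [IsFiniteMeasure p] : IsOdometerTypeRankOne p τ := by
  have hit : ∀ (i : ℕ) (x : X), τ^[i] x ∈ X₀ ↔ x ∈ X₀ := by
    intro i
    induction i with
    | zero => intro x; rfl
    | succ i ih => intro x; rw [Function.iterate_succ_apply, ih, hτX₀]
  have hcit : ∀ (k i : ℕ), ∀ x ∈ X₀, c k (τ^[i] x) = c k x + i := by
    intro k i
    induction i with
    | zero => intro x _; simp
    | succ i ih =>
      intro x hx
      rw [Function.iterate_succ_apply, ih _ ((hτX₀ x).2 hx), hcτ k x hx]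
      push_cast; ring
  let B : ℕ → Set X := fun k => X₀ ∩ c k ⁻¹' {0}
  have hB : ∀ k i, τ^[i] '' B k = X₀ ∩ c k ⁻¹' {(i : ZMod (h k))} := by
    intro k i
    ext x
    constructor
    · rintro ⟨y, ⟨hy, hy0⟩, rfl⟩
      refine ⟨(hit i y).2 hy, ?_⟩
      have hy0' : c k y = 0 := hy0
      simp [hcit k i y hy, hy0']
    · rintro ⟨hx, hxi⟩
      obtain ⟨y, rfl⟩ := τ.surjective.iterate i x
      have hy := (hit i y).1 hx
      refine ⟨y, ⟨hy, ?_⟩, rfl⟩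
      have hxi' : c k (τ^[i] y) = i := hxi
      rw [hcit k i y hy] at hxi'
      exact add_eq_right.1 hxi'
  refine ⟨h, B, fun k => ⟨hpos k, hdvd k⟩, fun k => ⟨?_, ?_⟩, ?_, ?_, ?_⟩
  · exact hX₀.inter (hc k (measurableSet_singleton _))
  · rintro x ⟨hx, hx0⟩
    refine ⟨hx, ?_⟩
    have hx0' : c (k + 1) x = 0 := hx0
    change c k x = 0
    rw [← hnest, hx0', map_zero]
  · intro k i hi j hj hij
    rw [hB, hB]
    refine Set.disjoint_left.2 fun x hx hx' => hij ?_
    have h1 : (i : ZMod (h k)) = j := hx.2.symm.trans hx'.2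
    rw [ZMod.natCast_eq_natCast_iff] at h1
    exact Nat.ModEq.eq_of_lt_of_lt h1 hi hj
  · intro k
    have : NeZero (h k) := ⟨(hpos k).ne'⟩
    refine measure_mono_null (Set.compl_subset_compl.2 fun x hx => ?_) hpX₀
    simp only [hB, Set.mem_iUnion]
    exact ⟨(c k x).val, Finset.mem_range.2 (ZMod.val_lt _), hx, by simp⟩
  · intro A hA ε hε
    obtain ⟨δ, hδ, hδε⟩ : ∃ δ : ℝ, 0 < δ ∧ ENNReal.ofReal δ ≤ ε := by
      refine ⟨(min ε 1).toReal, ENNReal.toReal_pos (by simp [hε.ne']) (by simp), ?_⟩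
      rw [ENNReal.ofReal_toReal (by simp)]
      exact min_le_left _ _
    obtain ⟨_, ⟨k, J, rfl⟩, ht⟩ := hdense.approx A hA (measure_ne_top _ _) δ hδ
    have : NeZero (h k) := ⟨(hpos k).ne'⟩
    classical
    refine ⟨k, (Finset.range (h k)).filter fun i : ℕ => (i : ZMod (h k)) ∈ J,
      Finset.filter_subset _ _, ?_⟩
    have h1 : (⋃ i ∈ (Finset.range (h k)).filter fun i : ℕ => (i : ZMod (h k)) ∈ J,
        τ^[i] '' B k) = X₀ ∩ c k ⁻¹' J := by
      ext x
      simp only [hB, Set.mem_iUnion, Finset.mem_filter, Finset.mem_range, Set.mem_inter_iff,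
        Set.mem_preimage, Set.mem_singleton_iff]
      constructor
      · rintro ⟨i, ⟨_, hiJ⟩, hx, hxi⟩
        exact ⟨hx, hxi ▸ hiJ⟩
      · rintro ⟨hx, hxJ⟩
        exact ⟨(c k x).val, ⟨ZMod.val_lt _, by simpa using hxJ⟩, hx, by simp⟩
    have h2 : (X₀ ∩ c k ⁻¹' J : Set X) =ᵐ[p] c k ⁻¹' J :=
      inter_ae_eq_right_of_ae_eq_univ (ae_eq_univ.2 hpX₀)
    rw [h1]
    exact (measure_congr (ae_eq_set_symmDiff (EventuallyEq.refl _ A) h2)).trans_lt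
      (ht.trans_le hδε)

/-- Functions of the coordinates `c k` are sums of eigenfunctions, as the characters of a finite
cyclic group span the functions on it. -/
theorem hasDiscreteSpectrum_of_coordinates {p : Measure X} [IsFiniteMeasure p] {τ : X → X}
    (hpos : ∀ k, 0 < h k) {c : ∀ k, X → ZMod (h k)} (hc : ∀ k, Measurable (c k))
    (hτ : MeasurePreserving τ p p) (hcτ : ∀ k, ∀ᵐ x ∂p, c k (τ x) = c k x + 1)
    (hdense : p.MeasureDense (levelSets c)) : HasDiscreteSpectrum p τ := by
  set V := Submodule.span ℂ {g : Lp ℂ 2 p | ∃ c : ℂ, ∀ᵐ x ∂p, g (τ x) = c * g x} with hV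
  have hmem : ∀ (k : ℕ) (u : ZMod (h k) → ℂ), MemLp (fun x => u (c k x)) 2 p := by
    intro k u
    have : NeZero (h k) := ⟨(hpos k).ne'⟩
    obtain ⟨C, hC⟩ := (Set.finite_range fun j => ‖u j‖).bddAbove
    exact MemLp.of_bound ((measurable_of_countable u).comp (hc k)).aestronglyMeasurable C
      (ae_of_all _ fun x => hC ⟨c k x, rfl⟩)
  let L : ∀ k, (ZMod (h k) → ℂ) →ₗ[ℂ] Lp ℂ 2 p := fun k =>
    { toFun := fun u => (hmem k u).toLp
      map_add' := fun u v => MemLp.toLp_add (hmem k u) (hmem k v)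
      map_smul' := fun a u => MemLp.toLp_const_smul a (hmem k u) }
  have hL : ∀ k u, L k u ∈ V := by
    intro k u
    have : NeZero (h k) := ⟨(hpos k).ne'⟩
    rw [← (AddChar.complexBasis (ZMod (h k))).sum_repr u, map_sum]
    refine Submodule.sum_mem _ fun χ _ => ?_
    rw [map_smul, AddChar.complexBasis_apply]
    refine Submodule.smul_mem _ _ (Submodule.subset_span ⟨χ 1, ?_⟩)
    have h1 := (hmem k χ).coeFn_toLp
    filter_upwards [h1, hτ.quasiMeasurePreserving.ae h1, hcτ k] with x hx hx' hxc
    change (hmem k χ).toLp _ (τ x) = χ 1 * (hmem k χ).toLp _ x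
    rw [hx, hx', hxc, AddChar.map_add_eq_mul, mul_comm]
  have : Fact ((2 : ℝ≥0∞) ≠ ∞) := ⟨by simp⟩
  rw [HasDiscreteSpectrum, ← hV, Submodule.eq_top_iff']
  refine Lp.induction (by simp) _ ?_ ?_ V.isClosed_topologicalClosure
  · intro a s hs hμs
    rw [Lp.simpleFunc.coe_indicatorConst]
    have h1 := hdense.indicatorConstLp_subset_closure 2 a ⟨s, hs, hμs.ne, rfl⟩
    refine closure_mono ?_ h1
    rintro _ ⟨_, ⟨k, J, rfl⟩, hμ, rfl⟩
    exact hL k (J.indicator fun _ => a)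
  · intro f g hf hg _ hf' hg'
    exact Submodule.add_mem _ hf' hg'

end OdometerCoordinates

section DyadicTower

variable {N : ℕ}

/-- The position of a point of the tower of height `N` over the dyadic odometer in the cyclic
group of order `N * 2 ^ k`. -/
noncomputable def dyadicTowerCoordinate (N k : ℕ) (z : Fin N × ℤ_[2]) : ZMod (N * 2 ^ k) :=
  ((z.1.val + N * (PadicInt.toZModPow k z.2).val : ℕ) : ZMod (N * 2 ^ k))

theorem measurable_dyadicTowerCoordinate (k : ℕ) : Measurable (dyadicTowerCoordinate N k) := by
  have h1 : Measurable fun z : Fin N × ℤ_[2] => (z.1, PadicInt.toZModPow k z.2) :=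
    measurable_fst.prodMk ((PadicInt.continuous_toZModPow k).measurable.comp measurable_snd)
  exact (measurable_of_countable fun w : Fin N × ZMod (2 ^ k) =>
    ((w.1.val + N * w.2.val : ℕ) : ZMod (N * 2 ^ k))).comp h1

theorem dyadicTowerCoordinate_constTower [NeZero N] (k : ℕ) (z : Fin N × ℤ_[2]) :
    dyadicTowerCoordinate N k (constTower N (MeasurableEquiv.addLeft 1) z) =
      dyadicTowerCoordinate N k z + 1 := by
  by_cases hz : z.1.val + 1 < N
  · rw [constTower_of_lt _ z hz]
    simp only [dyadicTowerCoordinate]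
    push_cast
    ring
  · have hN : z.1.val + 1 = N := by have := z.1.isLt; omega
    rw [constTower_of_not_lt _ z hz]
    simp only [dyadicTowerCoordinate, Fin.val_zero, MeasurableEquiv.coe_addLeft, map_add, map_one]
    rw [← Nat.cast_add_one, ZMod.natCast_eq_natCast_iff]
    have h1 : (1 + PadicInt.toZModPow k z.2).val ≡ (PadicInt.toZModPow k z.2).val + 1
        [MOD 2 ^ k] := by
      rw [← ZMod.natCast_eq_natCast_iff]
      simp [add_comm]
    have h2 := Nat.ModEq.mul_left' N h1
    rw [zero_add]
    convert h2 using 1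
    rw [mul_add, mul_one, add_right_comm, hN, add_comm]

theorem castHom_dyadicTowerCoordinate (hdvd : ∀ k, N * 2 ^ k ∣ N * 2 ^ (k + 1)) (k : ℕ)
    (z : Fin N × ℤ_[2]) :
    ZMod.castHom (hdvd k) (ZMod (N * 2 ^ k)) (dyadicTowerCoordinate N (k + 1) z) =
      dyadicTowerCoordinate N k z := by
  simp only [dyadicTowerCoordinate, map_natCast]
  rw [ZMod.natCast_eq_natCast_iff]
  refine Nat.ModEq.add_left _ (Nat.ModEq.mul_left' N ?_)
  rw [← ZMod.natCast_eq_natCast_iff, ZMod.natCast_val, ZMod.natCast_val,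
    PadicInt.cast_toZModPow k (k + 1) (Nat.le_succ k), ZMod.cast_id]

theorem eq_of_dyadicTowerCoordinate_eq [NeZero N] {z z' : Fin N × ℤ_[2]}
    (h : ∀ k, dyadicTowerCoordinate N k z = dyadicTowerCoordinate N k z') : z = z' := by
  have hN := Nat.pos_of_neZero N
  have h1 : ∀ k, z.1.val + N * (PadicInt.toZModPow k z.2).val ≡
      z'.1.val + N * (PadicInt.toZModPow k z'.2).val [MOD N * 2 ^ k] := fun k =>
    (ZMod.natCast_eq_natCast_iff _ _ _).1 (h k)
  have h2 : z.1 = z'.1 := by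
    have h3 : z.1.val ≡ z'.1.val [MOD N] := by
      have := (h1 0).of_mul_right (2 ^ 0)
      simpa [Nat.ModEq] using this
    exact Fin.ext (h3.eq_of_lt_of_lt z.1.isLt z'.1.isLt)
  refine Prod.ext h2 (PadicInt.ext_of_toZModPow.1 fun k => ?_)
  have h4 := h1 k
  rw [h2] at h4
  have h5 := Nat.ModEq.mul_left_cancel' hN.ne' (Nat.ModEq.add_left_cancel' _ h4)
  exact ZMod.val_injective _ (h5.eq_of_lt_of_lt (ZMod.val_lt _) (ZMod.val_lt _))

end DyadicTower

/-! ### Bounded remainder sets -/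

section BoundedRemainder

/-- The representative in `(0, 1]` of a point of the circle. -/
noncomputable def circleRep (x : UnitAddCircle) : ℝ := AddCircle.equivIoc 1 0 x

theorem circleRep_mem (x : UnitAddCircle) : circleRep x ∈ Set.Ioc (0 : ℝ) 1 := by
  obtain ⟨h1, h2⟩ := (AddCircle.equivIoc (1 : ℝ) 0 x).2
  exact ⟨h1, h2.trans_eq (zero_add 1)⟩

theorem coe_circleRep (x : UnitAddCircle) : (circleRep x : UnitAddCircle) = x :=
  (AddCircle.equivIoc (1 : ℝ) 0).symm_apply_apply x

theorem measurable_circleRep : Measurable circleRep :=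
  measurable_subtype_coe.comp (AddCircle.measurableEquivIoc (1 : ℝ) 0).measurable

theorem circleRep_eq {x : UnitAddCircle} {a : ℝ} (ha : a ∈ Set.Ioc (0 : ℝ) 1)
    (hax : (a : UnitAddCircle) = x) : circleRep x = a := by
  have h1 : ((circleRep x - a : ℝ) : UnitAddCircle) = 0 := by
    rw [AddCircle.coe_sub, coe_circleRep, hax, sub_self]
  obtain ⟨k, hk⟩ := (AddCircle.coe_eq_zero_iff (1 : ℝ)).1 h1
  obtain ⟨h2, h3⟩ := circleRep_mem x
  obtain ⟨h4, h5⟩ := ha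
  have hk' : (k : ℝ) = circleRep x - a := by simpa using hk
  have h6 : (-1 : ℝ) < k := by linarith
  have h7 : (k : ℝ) < 1 := by linarith
  have h8 : k = 0 := by
    have h9 : (-1 : ℤ) < k := by exact_mod_cast h6
    have h10 : k < (1 : ℤ) := by exact_mod_cast h7
    omega
  rw [h8] at hk'
  push_cast at hk'
  linarith

theorem circleRep_add_coe (x : UnitAddCircle) {b : ℝ} (hb : b ∈ Set.Icc (0 : ℝ) 1) :
    circleRep (x + b) = circleRep x + b - if 1 < circleRep x + b then 1 else 0 := by
  obtain ⟨h2, h3⟩ := circleRep_mem x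
  obtain ⟨h4, h5⟩ := hb
  split_ifs with h
  · refine circleRep_eq ⟨by linarith, by linarith⟩ ?_
    rw [AddCircle.coe_sub, AddCircle.coe_add, coe_circleRep, AddCircle.coe_period, sub_zero]
  · refine circleRep_eq ⟨by linarith, by linarith⟩ ?_
    rw [sub_zero, AddCircle.coe_add, coe_circleRep]

variable {Y : Type*} [MeasurableSpace Y]

/-- `F` is everywhere the coboundary of a bounded measurable function. -/
def IsStrictCoboundary (T : Y → Y) (F : Y → ℝ) : Prop :=
  ∃ g : Y → ℝ, Measurable g ∧ (∃ C, ∀ y, |g y| ≤ C) ∧ ∀ y, F y = g y - g (T y)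

namespace IsStrictCoboundary

variable {T : Y → Y} {F G : Y → ℝ}

theorem zero : IsStrictCoboundary T (fun _ => 0) := ⟨0, measurable_zero, ⟨0, by simp⟩, by simp⟩

theorem add (hF : IsStrictCoboundary T F) (hG : IsStrictCoboundary T G) :
    IsStrictCoboundary T (fun y => F y + G y) := by
  obtain ⟨f, hf, ⟨C, hC⟩, hfF⟩ := hF
  obtain ⟨g, hg, ⟨D, hD⟩, hgG⟩ := hG
  refine ⟨fun y => f y + g y, hf.add hg, ⟨C + D, fun y => ?_⟩, fun y => ?_⟩
  · exact (abs_add_le _ _).trans (add_le_add (hC y) (hD y))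
  · simp only [hfF, hgG]; ring

theorem const_mul (a : ℝ) (hF : IsStrictCoboundary T F) :
    IsStrictCoboundary T (fun y => a * F y) := by
  obtain ⟨f, hf, ⟨C, hC⟩, hfF⟩ := hF
  refine ⟨fun y => a * f y, hf.const_mul a, ⟨|a| * C, fun y => ?_⟩, fun y => ?_⟩
  · rw [abs_mul]
    exact mul_le_mul_of_nonneg_left (hC y) (abs_nonneg a)
  · simp only [hfF]; ring

theorem sum {ι : Type*} (s : Finset ι) {F : ι → Y → ℝ}
    (hF : ∀ i ∈ s, IsStrictCoboundary T (F i)) :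
    IsStrictCoboundary T (fun y => ∑ i ∈ s, F i y) := by
  classical
  induction s using Finset.induction_on with
  | empty => simpa using zero
  | insert i s hi ih =>
    simp only [Finset.sum_insert hi]
    exact (hF i (Finset.mem_insert_self i s)).add
      (ih fun j hj => hF j (Finset.mem_insert_of_mem hj))

theorem isBoundedCoboundary {q : Measure Y} [IsFiniteMeasure q]
    (hF : IsStrictCoboundary T F) : IsBoundedCoboundary q T F := by
  obtain ⟨g, hg, ⟨C, hC⟩, hgF⟩ := hF
  exact ⟨g, memLp_top_of_bound hg.aestronglyMeasurable C (ae_of_all _ hC), ae_of_all _ hgF⟩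

theorem integral_eq_zero {q : Measure Y} [IsFiniteMeasure q] (hT : MeasurePreserving T q q)
    (hF : IsStrictCoboundary T F) : ∫ y, F y ∂q = 0 := by
  obtain ⟨g, hg, ⟨C, hC⟩, hgF⟩ := hF
  have hint : Integrable g q := Integrable.of_bound hg.aestronglyMeasurable C (ae_of_all _ hC)
  have h1 : ∫ y, g (T y) ∂q = ∫ y, g y ∂q := by
    rw [← integral_map hT.measurable.aemeasurable
      (by rw [hT.map_eq]; exact hg.aestronglyMeasurable), hT.map_eq]
  simp only [hgF]
  have hint' : Integrable (fun y => g (T y)) q := hT.integrable_comp_of_integrable hint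
  rw [integral_sub hint hint', h1, sub_self]

end IsStrictCoboundary

/-- One bounded remainder set of density `b` is cut out of another one, `E`, of density `s`: on `E`
the angle `φ = θ - (b / s) h` is rotated by `b / s`, off `E` it is fixed, and the new set collects
the points of `E` whose angle passes the origin. -/
theorem exists_boundedRemainder_subset {T : Y → Y} {E : Set Y} (hE : MeasurableSet E) {s b : ℝ}
    (hb : 0 ≤ b) (hbs : b ≤ s)
    (hcob : IsStrictCoboundary T fun y => E.indicator (fun _ => 1) y - s)
    {θ : Y → UnitAddCircle} (hθ : Measurable θ) (hθT : ∀ y, θ (T y) = θ y + (b : UnitAddCircle)) :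
    ∃ A ⊆ E, MeasurableSet A ∧
      IsStrictCoboundary T fun y => A.indicator (fun _ => (1 : ℝ)) y - b := by
  classical
  obtain ⟨h, hh, ⟨C, hC⟩, hhE⟩ := hcob
  obtain ⟨β, hβ, hβs⟩ : ∃ β ∈ Set.Icc (0 : ℝ) 1, β * s = b := by
    -- If `s = 0`, then also `b = 0`.
    rcases (hb.trans hbs).eq_or_lt with hs | hs
    · exact ⟨0, by simp, by rw [zero_mul]; linarith⟩
    · exact ⟨b / s, ⟨div_nonneg hb hs.le, (div_le_one hs).2 hbs⟩, div_mul_cancel₀ b hs.ne'⟩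
  let φ : Y → UnitAddCircle := fun y => θ y - ((β * h y : ℝ) : UnitAddCircle)
  have hφ : Measurable φ := hθ.sub (AddCircle.measurable_mk'.comp (hh.const_mul β))
  have hφT : ∀ y, φ (T y) = φ y + ((β * E.indicator (fun _ => 1) y : ℝ) : UnitAddCircle) := by
    intro y
    have h1 : h (T y) = h y - E.indicator (fun _ => 1) y + s := by linarith [hhE y]
    have h2 : β * h (T y) = β * h y - β * E.indicator (fun _ => 1) y + b := by
      rw [h1, ← hβs]; ring
    simp only [φ, hθT, h2, AddCircle.coe_add, AddCircle.coe_sub]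
    abel
  let A : Set Y := E ∩ {y | 1 < circleRep (φ y) + β}
  have hmφ : Measurable fun y => circleRep (φ y) := measurable_circleRep.comp hφ
  have hA : ∀ y, A.indicator (fun _ => (1 : ℝ)) y =
      β * E.indicator (fun _ => 1) y + circleRep (φ y) - circleRep (φ (T y)) := by
    intro y
    by_cases hy : y ∈ E
    · rw [hφT, Set.indicator_of_mem hy, mul_one, circleRep_add_coe _ hβ]
      by_cases hy' : 1 < circleRep (φ y) + β
      · rw [Set.indicator_of_mem (show y ∈ A from ⟨hy, hy'⟩), if_pos hy']; ring
      · rw [Set.indicator_of_notMem (fun hyA : y ∈ A => hy' hyA.2), if_neg hy']; ring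
    · rw [hφT, Set.indicator_of_notMem hy, Set.indicator_of_notMem (fun hyA : y ∈ A => hy hyA.1)]
      simp
  refine ⟨A, Set.inter_subset_left,
    hE.inter (measurableSet_lt measurable_const (hmφ.add_const β)),
    fun y => β * h y + circleRep (φ y), (hh.const_mul β).add hmφ, ⟨|β| * C + 1, fun y => ?_⟩,
    fun y => ?_⟩
  · refine (abs_add_le _ _).trans (add_le_add ?_ ?_)
    · rw [abs_mul]
      exact mul_le_mul_of_nonneg_left (hC y) (abs_nonneg β)
    · obtain ⟨h1, h2⟩ := circleRep_mem (φ y)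
      rwa [abs_of_pos h1]
  · have h1 := hhE y
    simp only at h1 ⊢
    rw [hA, ← hβs]
    linear_combination β * h1

/-- Disjoint bounded remainder sets with densities `b 0, b 1, …` are cut out of `E` one after the
other, given for each density an eigenfunction whose eigenvalue has this density as its angle. -/
theorem exists_disjoint_boundedRemainder {T : Y → Y} {m : ℕ} (b : Fin m → ℝ) (hb : ∀ j, 0 ≤ b j)
    (θ : Fin m → Y → UnitAddCircle) (hθ : ∀ j, Measurable (θ j))
    (hθT : ∀ j y, θ j (T y) = θ j y + (b j : UnitAddCircle)) {E : Set Y} (hE : MeasurableSet E)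
    {s : ℝ} (hbs : ∑ j, b j ≤ s)
    (hcob : IsStrictCoboundary T fun y => E.indicator (fun _ => 1) y - s) :
    ∃ A : Fin m → Set Y, (∀ j, A j ⊆ E) ∧ (∀ j, MeasurableSet (A j)) ∧
      (∀ i j, i ≠ j → Disjoint (A i) (A j)) ∧
      ∀ j, IsStrictCoboundary T fun y => (A j).indicator (fun _ => (1 : ℝ)) y - b j := by
  induction m generalizing E s with
  | zero =>
    exact ⟨fun j => j.elim0, fun j => j.elim0, fun j => j.elim0, fun j => j.elim0,
      fun j => j.elim0⟩
  | succ m ih =>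
    rw [Fin.sum_univ_succ] at hbs
    have hpos : 0 ≤ ∑ j : Fin m, b j.succ := Finset.sum_nonneg fun j _ => hb _
    obtain ⟨A₀, hA₀E, hA₀, hA₀cob⟩ :=
      exists_boundedRemainder_subset hE (hb 0) (by linarith) hcob (hθ 0) (hθT 0)
    have hcob' : IsStrictCoboundary T
        fun y => (E \ A₀).indicator (fun _ => 1) y - (s - b 0) := by
      have h1 := hcob.add (hA₀cob.const_mul (-1))
      convert h1 using 2 with y
      rw [Set.indicator_sdiff hA₀E, Pi.sub_apply]
      ring
    obtain ⟨A, hAE, hA, hdisj, hAcob⟩ := ih (fun j => b j.succ) (fun j => hb _)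
      (fun j => θ j.succ) (fun j => hθ _) (fun j => hθT _) (hE.diff hA₀)
      (s := s - b 0) (by linarith) hcob'
    refine ⟨Fin.cons A₀ A, ?_, ?_, ?_, ?_⟩
    · intro j
      cases j using Fin.cases with
      | zero => exact hA₀E
      | succ j => exact (hAE j).trans Set.sdiff_subset
    · intro j
      cases j using Fin.cases with
      | zero => exact hA₀
      | succ j => exact hA j
    · have h0 : ∀ j, Disjoint A₀ (A j) := fun j =>
        Set.disjoint_left.2 fun y hy hy' => (hAE j hy').2 hy
      intro i j hij
      cases i using Fin.cases with
      | zero =>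
        cases j using Fin.cases with
        | zero => exact absurd rfl hij
        | succ j => exact h0 j
      | succ i =>
        cases j using Fin.cases with
        | zero => exact (h0 i).symm
        | succ j => exact hdisj i j fun h => hij (by rw [h])
    · intro j
      cases j using Fin.cases with
      | zero => exact hA₀cob
      | succ j => exact hAcob j

end BoundedRemainder

/-! ### Rational dependence of finitely many reals -/

section RationalDependence

/-- A common denominator for finitely many rationals. -/
theorem exists_common_denominator {ι : Type*} [Fintype ι] (r : ι → ℚ) :
    ∃ N : ℕ, 0 < N ∧ ∃ n : ι → ℤ, ∀ i, r i * N = n i := by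
  refine ⟨∏ i, (r i).den, Finset.prod_pos fun i _ => (r i).den_pos, ?_⟩
  choose k hk using fun i => Finset.dvd_prod_of_mem (fun i => (r i).den) (Finset.mem_univ i)
  refine ⟨fun i => (r i).num * k i, fun i => ?_⟩
  simp only [hk i]
  push_cast
  rw [← mul_assoc, Rat.mul_den_eq_num]

/-- Finitely many reals are integral combinations of `1 / N` and of reals `α l` such that `1` and
the `N * α l` are rationally independent. -/
theorem exists_integral_coordinates {m : ℕ} (b : Fin m → ℝ) :
    ∃ (N d : ℕ) (α : Fin d → ℝ) (n : Fin m → ℤ) (c : Fin m → Fin d → ℤ), 0 < N ∧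
      (∀ j, b j = n j / N + ∑ l, c j l * α l) ∧
      ∀ k : Fin d → ℤ, (∃ z : ℤ, ∑ l, k l * (N * α l) = z) → k = 0 := by
  -- The `N * α l` lift a basis of the `ℚ`-span of the `b j` in `ℝ / ℚ`.
  let Q : Submodule ℚ ℝ := Submodule.span ℚ {1}
  let W : Submodule ℚ (ℝ ⧸ Q) := Submodule.span ℚ (Set.range fun j => Q.mkQ (b j))
  have : FiniteDimensional ℚ W := FiniteDimensional.span_of_finite ℚ (Set.finite_range _)
  let w := Module.finBasis ℚ W
  choose a ha using fun l => Q.mkQ_surjective (w l : ℝ ⧸ Q)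
  have hker : ∀ x, x ∈ Q ↔ Q.mkQ x = 0 := fun x => by
    rw [← LinearMap.mem_ker, Submodule.ker_mkQ]
  have hbW : ∀ j, Q.mkQ (b j) ∈ W := fun j => Submodule.subset_span ⟨j, rfl⟩
  have hres : ∀ j, ∃ t : ℚ, (t : ℝ) = b j - ∑ l, w.repr ⟨_, hbW j⟩ l • a l := by
    intro j
    have h1 : b j - ∑ l, w.repr ⟨_, hbW j⟩ l • a l ∈ Q := by
      rw [hker, map_sub, map_sum, sub_eq_zero]
      simp only [map_smul, ha]
      have h2 := congrArg W.subtype (w.sum_repr ⟨_, hbW j⟩)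
      rw [map_sum] at h2
      exact h2.symm
    obtain ⟨t, ht⟩ := Submodule.mem_span_singleton.1 h1
    exact ⟨t, by rw [← ht, Rat.smul_def, mul_one]⟩
  choose t ht using hres
  obtain ⟨N, hN, n, hn⟩ := exists_common_denominator
    (Sum.elim t fun jl : Fin m × Fin (Module.finrank ℚ W) => w.repr ⟨_, hbW jl.1⟩ jl.2)
  have hN' : (N : ℝ) ≠ 0 := by exact_mod_cast hN.ne'
  refine ⟨N, _, fun l => a l / N, fun j => n (Sum.inl j), fun j l => n (Sum.inr (j, l)), hN,
    fun j => ?_, fun k hk => ?_⟩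
  · have h1 : (t j : ℝ) * N = n (Sum.inl j) := by exact_mod_cast hn (Sum.inl j)
    have h2 : ∀ l, (w.repr ⟨_, hbW j⟩ l : ℝ) * N = n (Sum.inr (j, l)) := fun l => by
      exact_mod_cast hn (Sum.inr (j, l))
    have h3 : ∀ l, (n (Sum.inr (j, l)) : ℝ) * (a l / N) = w.repr ⟨_, hbW j⟩ l • a l := fun l => by
      rw [← h2, Rat.smul_def]; field_simp
    rw [← h1, mul_div_cancel_right₀ _ hN', ht]
    simp only [h3]
    ring
  · obtain ⟨z, hz⟩ := hk
    have h1 : ∑ l, (k l : ℚ) • a l = (z : ℝ) := by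
      rw [← hz]
      refine Finset.sum_congr rfl fun l _ => ?_
      rw [Rat.smul_def]; push_cast; field_simp
    have h2 : ∑ l, (k l : ℚ) • w l = 0 := by
      refine Subtype.ext ?_
      have h3 : Q.mkQ (z : ℝ) = 0 :=
        (hker _).1 (Submodule.mem_span_singleton.2 ⟨z, by simp [Rat.smul_def]⟩)
      rw [← h1, map_sum] at h3
      simpa [ha] using h3
    funext l
    have h4 := Fintype.linearIndependent_iff.1 w.linearIndependent (fun l => (k l : ℚ)) h2 l
    exact_mod_cast h4

end RationalDependence

/-! ### Realizing a step function over a model system -/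

section Realization

variable {X Y : Type*} {m : ℕ}

/-- The index function of a finite disjoint family: `j + 1` on the `j`-th set and `0` off all of
them. -/
noncomputable def partitionIndex (A : Fin m → Set X) (x : X) : ℕ :=
  ∑ j, (A j).indicator (fun _ => j.val + 1) x

theorem partitionIndex_of_mem {A : Fin m → Set X} (hA : ∀ i j, i ≠ j → Disjoint (A i) (A j))
    {x : X} {j : Fin m} (hx : x ∈ A j) : partitionIndex A x = j.val + 1 := by
  rw [partitionIndex, Finset.sum_eq_single j, Set.indicator_of_mem hx]
  · intro i _ hij
    exact Set.indicator_of_notMem (Set.disjoint_right.1 (hA i j hij) hx) _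
  · intro h; exact absurd (Finset.mem_univ j) h

theorem partitionIndex_eq_iff {A : Fin m → Set X} (hA : ∀ i j, i ≠ j → Disjoint (A i) (A j))
    (x : X) (j : Fin m) : partitionIndex A x = j.val + 1 ↔ x ∈ A j := by
  refine ⟨fun h => ?_, partitionIndex_of_mem hA⟩
  by_contra hx
  have h0 : partitionIndex A x = 0 := by
    refine Finset.sum_eq_zero fun i _ => Set.indicator_of_notMem (fun hi => hx ?_) _
    have h1 := partitionIndex_of_mem hA hi
    have h2 : i = j := Fin.ext (by omega)
    exact h2 ▸ hi
  omega

/-- A step function is a function of the index. -/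
theorem sum_indicator_eq_of_partitionIndex {A : Fin m → Set X}
    (hA : ∀ i j, i ≠ j → Disjoint (A i) (A j)) (a : Fin m → ℝ) (x : X) :
    ∑ j, (A j).indicator (fun _ => a j) x =
      ∑ j : Fin m, if partitionIndex A x = j.val + 1 then a j else 0 := by
  classical
  refine Finset.sum_congr rfl fun j _ => ?_
  rw [Set.indicator_apply]
  exact if_congr (partitionIndex_eq_iff hA x j).symm rfl rfl

variable [MeasurableSpace X] [MeasurableSpace Y]

theorem map_partitionIndex_singleton {p : Measure X} [IsProbabilityMeasure p] {A : Fin m → Set X}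
    (hA : ∀ i j, i ≠ j → Disjoint (A i) (A j)) (hm : ∀ j, NullMeasurableSet (A j) p)
    (hp : p (⋃ j, A j) = 1) {u : X → ℕ} (hu : Measurable u)
    (hueq : partitionIndex A =ᵐ[p] u) (n : ℕ) :
    p.map u {n} = ∑ j : Fin m, if n = j.val + 1 then p (A j) else 0 := by
  classical
  have h1 : p.map u {n} = p {x | partitionIndex A x = n} := by
    rw [Measure.map_apply hu (measurableSet_singleton n)]
    refine measure_congr ?_
    filter_upwards [hueq] with x hx
    exact propext (by change u x = n ↔ partitionIndex A x = n; rw [hx])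
  rw [h1]
  by_cases hn : ∃ j : Fin m, n = j.val + 1
  · obtain ⟨j, rfl⟩ := hn
    rw [Finset.sum_eq_single j (fun i _ hij => if_neg fun h => hij (Fin.ext (by omega)))
      (fun h => absurd (Finset.mem_univ j) h), if_pos rfl]
    congr 1
    ext x
    exact partitionIndex_eq_iff hA x j
  · push Not at hn
    rw [Finset.sum_eq_zero fun j _ => if_neg (hn j)]
    have h2 : {x | partitionIndex A x = n} ⊆ (⋃ j, A j)ᶜ := ?_
    · exact measure_mono_null h2 ((prob_compl_eq_zero_iff₀ (NullMeasurableSet.iUnion hm)).2 hp)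
    intro x hx hx'
    obtain ⟨j, hj⟩ := Set.mem_iUnion.1 hx'
    exact hn j (hx.symm.trans (partitionIndex_of_mem hA hj))

/-- If the measures `p (A j)` occur as the angles of eigenvalues of an automorphism `T` of a
non-atomic standard Borel probability space, then a mean zero step function with steps `A j`
corresponds, under a suitable isomorphism, to a bounded `T`-coboundary. -/
theorem exists_mod0Equiv_isBoundedCoboundary [StandardBorelSpace X] [StandardBorelSpace Y]
    {p : Measure X} [IsProbabilityMeasure p] [NullSingletonClass p] {q : Measure Y}
    [IsProbabilityMeasure q] [NullSingletonClass q] {T : Y → Y} (hT : MeasurePreserving T q q)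
    (a : Fin m → ℝ) {A : Fin m → Set X} (hm : ∀ j, NullMeasurableSet (A j) p)
    (hA : ∀ i j, i ≠ j → Disjoint (A i) (A j)) (hp : p (⋃ j, A j) = 1)
    (hmean : ∫ x, ∑ j, (A j).indicator (fun _ => a j) x ∂p = 0)
    (θ : Fin m → Y → UnitAddCircle) (hθ : ∀ j, Measurable (θ j))
    (hθT : ∀ j y, θ j (T y) = θ j y + (p.real (A j) : UnitAddCircle)) :
    ∃ (e : Mod0Equiv p q) (f' : Y → ℝ), IsBoundedCoboundary q T f' ∧
      ∀ᵐ x ∂p, ∑ j, (A j).indicator (fun _ => a j) x = f' (e.toFun x) := by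
  have hsum : ∑ j, p.real (A j) = 1 := by
    have h1 : p (⋃ j, A j) = ∑ j, p (A j) := by
      rw [measure_iUnion₀ (fun i j hij => (hA i j hij).aedisjoint) hm, tsum_fintype]
    rw [hp] at h1
    simp only [Measure.real]
    rw [← ENNReal.toReal_sum fun j _ => measure_ne_top p _, ← h1, ENNReal.toReal_one]
  have hmean' : ∑ j, a j * p.real (A j) = 0 := by
    rw [integral_finsetSum _ fun j _ => (integrable_const (a j)).indicator₀ (hm j)] at hmean
    rw [← hmean]
    refine Finset.sum_congr rfl fun j _ => ?_
    rw [integral_indicator₀ (hm j), setIntegral_const, smul_eq_mul, mul_comm]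
  obtain ⟨A', -, hmA', hA', hcob⟩ := exists_disjoint_boundedRemainder (fun j => p.real (A j))
    (fun j => measureReal_nonneg) θ hθ hθT MeasurableSet.univ (s := 1) hsum.le
    (by simpa using IsStrictCoboundary.zero)
  -- An invariant measure gives a bounded remainder set the measure prescribed by its density.
  have hqA' : ∀ j, q (A' j) = p (A j) := by
    intro j
    have h1 := (hcob j).integral_eq_zero hT
    rw [integral_sub ((integrable_const _).indicator (hmA' j)) (integrable_const _),
      integral_indicator (hmA' j)] at h1
    simp only [integral_const, smul_eq_mul, mul_one, measureReal_restrict_apply_univ,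
      probReal_univ, one_mul, sub_eq_zero] at h1
    exact (measureReal_eq_measureReal_iff).1 h1
  have hqU : q (⋃ j, A' j) = 1 := by
    rw [measure_iUnion (fun i j hij => hA' i j hij) hmA', tsum_fintype]
    simp only [hqA']
    rw [← hp, measure_iUnion₀ (fun i j hij => (hA i j hij).aedisjoint) hm, tsum_fintype]
  have hu : AEMeasurable (partitionIndex A) p := by
    unfold partitionIndex
    exact Finset.aemeasurable_fun_sum _ fun j _ => aemeasurable_const.indicator₀ (hm j)
  have hv : Measurable (partitionIndex A') := by
    unfold partitionIndex
    exact Finset.measurable_fun_sum _ fun j _ => measurable_const.indicator (hmA' j)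
  have hlaw : p.map (hu.mk _) = q.map (partitionIndex A') := by
    refine Measure.ext_of_singleton fun n => ?_
    rw [map_partitionIndex_singleton hA hm hp hu.measurable_mk hu.ae_eq_mk,
      map_partitionIndex_singleton hA' (fun j => (hmA' j).nullMeasurableSet) hqU hv
        (EventuallyEq.refl _ _)]
    simp only [hqA']
  obtain ⟨e, he⟩ := exists_mod0Equiv_of_map_eq p q hu.measurable_mk hv hlaw
  refine ⟨e, fun y => ∑ j, (A' j).indicator (fun _ => a j) y, ?_, ?_⟩
  · have h1 := IsStrictCoboundary.sum Finset.univ fun j _ => (hcob j).const_mul (a j)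
    have h2 : (fun y => ∑ j, (A' j).indicator (fun _ => a j) y) =
        fun y => ∑ j, a j * ((A' j).indicator (fun _ => (1 : ℝ)) y - p.real (A j)) := by
      funext y
      simp only [mul_sub, Finset.sum_sub_distrib, hmean', sub_zero]
      refine Finset.sum_congr rfl fun j _ => ?_
      by_cases hy : y ∈ A' j <;> simp [hy]
    rw [h2]
    exact h1.isBoundedCoboundary
  · filter_upwards [he, hu.ae_eq_mk] with x hx hx'
    rw [sum_indicator_eq_of_partitionIndex hA, sum_indicator_eq_of_partitionIndex hA', hx, hx']

end Realization

/-! ### The two model systems -/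

section Models

variable {N : ℕ} [NeZero N]

/-- The level of a tower of height `N`, read modulo `N`, gives the eigenvalues with angle in
`(1 / N) ℤ`. -/
theorem coe_level_constTower {Ω : Type*} [MeasurableSpace Ω] (S : Ω ≃ᵐ Ω) (n : ℤ)
    (z : Fin N × Ω) :
    ((n * (constTower N S z).1.val / N : ℝ) : UnitAddCircle) =
      ((n * z.1.val / N : ℝ) : UnitAddCircle) + ((n / N : ℝ) : UnitAddCircle) := by
  have hN : (N : ℝ) ≠ 0 := NeZero.ne _
  rw [← AddCircle.coe_add]
  by_cases h : z.1.val + 1 < N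
  · rw [constTower_of_lt S z h]
    congr 1
    push_cast
    ring
  · have h1 : (z.1.val : ℝ) + 1 = N := by
      have := z.1.isLt
      exact_mod_cast (show z.1.val + 1 = N by omega)
    rw [constTower_of_not_lt S z h]
    have h2 : (n * z.1.val / N + n / N : ℝ) = n := by
      rw [← add_div, ← mul_add_one, h1, mul_div_cancel_right₀ _ hN]
    rw [h2, Fin.val_zero, Nat.cast_zero, mul_zero, zero_div, AddCircle.coe_zero, eq_comm,
      AddCircle.coe_eq_zero_iff]
    exact ⟨n, by simp⟩

variable {d : ℕ}

/-- The factor map of the tower of height `N` over the rotation by `N α` onto the rotation by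
`α`. -/
noncomputable def towerToTorus (α : Torus d) (z : Fin N × Torus d) : Torus d :=
  fun l => z.2 l + z.1.val • α l

theorem towerToTorus_constTower (α : Torus d) (z : Fin N × Torus d) :
    towerToTorus α (constTower N (MeasurableEquiv.addRight (N • α)) z) =
      torusRotation α (towerToTorus α z) := by
  funext l
  by_cases h : z.1.val + 1 < N
  · rw [constTower_of_lt _ z h]
    simp only [towerToTorus, torusRotation, succ_nsmul, add_assoc]
  · have h1 : N = z.1.val + 1 := by have := z.1.isLt; omega
    rw [constTower_of_not_lt _ z h]
    have h2 : N • α l = z.1.val • α l + α l := by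
      rw [← succ_nsmul, ← h1]
    simp [towerToTorus, torusRotation, h2, add_assoc]

theorem measurePreserving_towerToTorus (α : Torus d) :
    MeasurePreserving (towerToTorus α : Fin N × Torus d → Torus d)
      ((finUniform N).prod volume) volume := by
  have h1 : MeasurePreserving
      (fun z : Fin N × Torus d => (z.1, z.2 + fun l => z.1.val • α l))
      ((finUniform N).prod volume) ((finUniform N).prod volume) := by
    refine (MeasurePreserving.id _).skew_product
      (g := fun (i : Fin N) (y : Torus d) => y + fun l => i.val • α l) ?_
      (ae_of_all _ fun i => (measurePreserving_add_right volume (fun l => i.val • α l)).map_eq)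
    exact measurable_snd.add
      ((measurable_of_countable fun i : Fin N => (fun l => i.val • α l : Torus d)).comp
        measurable_fst)
  exact measurePreserving_snd.comp h1

/-- Every fibre of `towerToTorus` has one point on each level. -/
theorem encard_fibre_towerToTorus {N : ℕ} (α : Torus d) {s : Set (Fin N × Torus d)}
    (hs : ∀ᵐ z ∂(finUniform N).prod (volume : Measure (Torus d)), z ∈ s) :
    ∀ᵐ x ∂(volume : Measure (Torus d)), (s ∩ towerToTorus α ⁻¹' {x}).encard = N := by
  have h1 : ∀ i : Fin N, ∀ᵐ y ∂(volume : Measure (Torus d)), (i, y) ∈ s :=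
    forall_of_ae_finUniform (Measure.ae_ae_of_ae_prod hs)
  have h2 : ∀ i : Fin N, ∀ᵐ x ∂(volume : Measure (Torus d)),
      (i, x + -fun l => i.val • α l) ∈ s := fun i =>
    (measurePreserving_add_right volume (-fun l => i.val • α l)).quasiMeasurePreserving.ae (h1 i)
  filter_upwards [ae_all_iff.2 h2] with x hx
  have h3 : s ∩ towerToTorus α ⁻¹' {x} =
      Set.range fun i : Fin N => (i, x + -fun l => i.val • α l) := by
    ext ⟨i, y⟩
    constructor
    · rintro ⟨_, hy⟩
      refine ⟨i, Prod.ext rfl ?_⟩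
      rw [← show towerToTorus α (i, y) = x from hy]
      funext l
      simp [towerToTorus]
    · rintro ⟨j, hj⟩
      obtain ⟨rfl, rfl⟩ := Prod.mk.inj hj
      refine ⟨hx j, ?_⟩
      change towerToTorus α _ = x
      funext l
      simp [towerToTorus]
  have h4 : Function.Injective fun i : Fin N => (i, x + -fun l => i.val • α l) :=
    fun i j hij => (Prod.mk.inj hij).1
  rw [h3, ← Set.image_univ, h4.encard_image, Set.encard_univ]
  simp

end Models

theorem mainTheorem4 {X : Type*} [MeasurableSpace X] [StandardBorelSpace X]
    (p : Measure X) [IsProbabilityMeasure p] [NullSingletonClass p]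
    (f : X → ℝ) (hstep : IsFiniteStep p f) (hmean : ∫ x, f x ∂p = 0) :
    ∃ τ : X ≃ᵐ X, Ergodic τ p ∧ IsBoundedCoboundary p τ f ∧
      ((HasDiscreteSpectrum p τ ∧ IsOdometerTypeRankOne p τ) ∨
        IsProductOfRotations p τ ∨
        IsFiniteExtensionOfRotations p τ) := by
  obtain ⟨m, a, A, hm, hA, hp, hf⟩ := hstep
  rw [integral_congr_ae hf] at hmean
  obtain ⟨N, d, α, n, c, hN, hb, hind⟩ := exists_integral_coordinates fun j => p.real (A j)
  have : NeZero N := ⟨hN.ne'⟩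
  rcases Nat.eq_zero_or_pos d with rfl | hd
  · -- All measures are multiples of `1 / N`: the model is a tower over the dyadic odometer.
    let S : ℤ_[2] ≃ᵐ ℤ_[2] := MeasurableEquiv.addLeft 1
    have hS : Ergodic S (padicHaar 2) := ergodic_padic_add_one
    have hT := measurePreserving_constTower (N := N) hS.toMeasurePreserving
    obtain ⟨e, f', hf', hff'⟩ := exists_mod0Equiv_isBoundedCoboundary hT a hm hA hp hmean
      (fun j z => ((n j * z.1.val / N : ℝ) : UnitAddCircle))
      (fun j => (measurable_of_countable fun i : Fin N =>
        ((n j * i.val / N : ℝ) : UnitAddCircle)).comp measurable_fst)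
      (fun j z => by
        rw [coe_level_constTower S (n j) z, hb j]
        simp)
    obtain ⟨τ, X₀, hτ, hX₀, hpX₀, hτX₀, hl, hconj, hr⟩ := e.exists_transport _ hT
    have hX₀ae : ∀ᵐ x ∂p, x ∈ X₀ := hpX₀
    have hconj' := hX₀ae.mono hconj
    have hpos : ∀ k, 0 < N * 2 ^ k := fun k => by positivity
    have hdvd : ∀ k, N * 2 ^ k ∣ N * 2 ^ (k + 1) := fun k =>
      Nat.mul_dvd_mul_left N (pow_dvd_pow 2 k.le_succ)
    have hc : ∀ k, Measurable fun x => dyadicTowerCoordinate N k (e.toFun x) := fun k =>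
      (measurable_dyadicTowerCoordinate k).comp e.measurePreserving_toFun.measurable
    have hcτ : ∀ k, ∀ x ∈ X₀, dyadicTowerCoordinate N k (e.toFun (τ x)) =
        dyadicTowerCoordinate N k (e.toFun x) + 1 := fun k x hx => by
      rw [hconj x hx, dyadicTowerCoordinate_constTower]
    have hdense := e.measureDense_levelSets (measureDense_levelSets
      ((finUniform N).prod (padicHaar 2)) measurable_dyadicTowerCoordinate hdvd
      (castHom_dyadicTowerCoordinate hdvd) fun _ _ => eq_of_dyadicTowerCoordinate_eq)
    refine ⟨τ, e.ergodic_of_ae_conj hτ (ergodic_constTower hS) hconj',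
      e.isBoundedCoboundary hconj' ?_ hf', Or.inl ⟨?_, ?_⟩⟩
    · filter_upwards [hf, hff'] with x h1 h2
      rw [h1, h2]
    · exact hasDiscreteSpectrum_of_coordinates hpos hc hτ
        (fun k => hX₀ae.mono (hcτ k)) hdense
    · exact isOdometerTypeRankOne_of_coordinates τ hX₀ hpX₀ hτX₀ hpos hdvd hc hcτ
        (fun k x => castHom_dyadicTowerCoordinate hdvd k _) hdense
  · -- Otherwise the model is a tower over the rotation of a torus by `N α`.
    let β : Torus d := fun l => (α l : UnitAddCircle)
    have hβN : N • β = fun l => ((N * α l : ℝ) : UnitAddCircle) := by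
      funext l
      simp [β, ← nsmul_eq_mul]
    have hS : Ergodic (MeasurableEquiv.addRight (N • β)) (volume : Measure (Torus d)) := by
      refine ergodic_torus_add_right fun k hk h => hk (hind k ?_)
      rw [hβN] at h
      exact (mFourier_coe_eq_one_iff k _).1 h
    have : Nonempty (Fin d) := ⟨⟨0, hd⟩⟩
    have hT := measurePreserving_constTower (N := N) hS.toMeasurePreserving
    have hπ := measurePreserving_towerToTorus (N := N) β
    obtain ⟨e, f', hf', hff'⟩ := exists_mod0Equiv_isBoundedCoboundary hT a hm hA hp hmean
      (fun j z => ((n j * z.1.val / N : ℝ) : UnitAddCircle) + ∑ l, c j l • towerToTorus β z l)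
      (fun j => ((measurable_of_countable fun i : Fin N =>
        ((n j * i.val / N : ℝ) : UnitAddCircle)).comp measurable_fst).add
          (Finset.measurable_fun_sum _ fun l _ =>
            ((measurable_pi_apply l).comp hπ.measurable).const_smul (c j l)))
      (fun j z => by
        rw [coe_level_constTower _ (n j) z, towerToTorus_constTower, hb j]
        have h1 : ((∑ l, c j l * α l : ℝ) : UnitAddCircle) = ∑ l, c j l • β l := by
          rw [← QuotientAddGroup.mk'_apply, map_sum]
          simp [β, ← zsmul_eq_mul]
        simp only [torusRotation, smul_add, Finset.sum_add_distrib, AddCircle.coe_add, h1]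
        abel)
    obtain ⟨τ, X₀, hτ, hX₀, hpX₀, hτX₀, hl, hconj, hr⟩ := e.exists_transport _ hT
    have hX₀ae : ∀ᵐ x ∂p, x ∈ X₀ := hpX₀
    have hconj' := hX₀ae.mono hconj
    refine ⟨τ, e.ergodic_of_ae_conj hτ (ergodic_constTower hS) hconj',
      e.isBoundedCoboundary hconj' ?_ hf', Or.inr (Or.inr ⟨⟨d, β, hd, ?_⟩, ⟨d, N • β, hd, ?_⟩⟩)⟩
    · filter_upwards [hf, hff'] with x h1 h2
      rw [h1, h2]
    · exact e.isFiniteToOneExtension hconj' hπ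
        (ae_of_all _ fun z => towerToTorus_constTower β z) hX₀ hpX₀ hl hr hN
        fun s hs => encard_fibre_towerToTorus β hs
    · obtain ⟨e', he'⟩ := exists_mod0Equiv_towerMeasure (N := N)
        (μ := (volume : Measure (Torus d))) (MeasurableEquiv.addRight (N • β))
      refine ⟨fun _ => N - 1, N - 1, measurable_const, fun _ => le_rfl,
        (e.trans e').isIsomorphicMod0 ?_⟩
      filter_upwards [hconj'] with x hx
      change e'.toFun (e.toFun (τ x)) = towerMap _ _ (e'.toFun (e.toFun x))
      rw [hx, he']
      rfl
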